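/- Let $L\subset\mathbf R^3=\{(p,q,u)\}$ be a Legendrian link for the contact form $du-p\,dq$, i.e. a finite disjoint union of smoothly embedded closed curves on which this form vanishes. Let $\pi(p,q,u)=(p,q)$ and let $Y=\pi(L)$. Assume that $L$ is generic: no three distinct points of $L$ have the same projection, and at every double point of $Y$ (the common projection of two distinct points of $L$) the two branches of $Y$ are transverse. The branch with the larger value of $u$ is called the upper one, the other the lower one. Orient $\mathbf R^2$ by $dp\wedge dq$. At a double point the two branches bound four sectors; a sector is *positive* if it is swept out by rotating a ray of the lower branch counterclockwise to a ray of the upper branch, and *negative* if it is swept out by rotating a ray of the upper branch counterclockwise to a ray of the lower branch. For every $k\ge 1$ fix a curved convex $k$-gon $\Pi_k\subset\mathbf R^2$: a compact convex set with non-empty interior whose boundary is a simple closed curve consisting of $k$ smooth regular arcs, with interior angles strictly between $0$ and $\pi$ at its vertices $x_0,\dots,x_{k-1}$, numbered counterclockwise. Let $W_k(Y)$ be the set of smooth orientation-preserving immersions $f:\Pi_k\to\mathbf R^2$ (smooth up to the boundary) with $f(\partial\Pi_k)\subset Y$, and let $\widetilde W_k(Y)$ be its quotient by the group of orientation-preserving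 diffeomorphisms of $\Pi_k$ that fix all vertices, acting by reparametrization. A vertex $x_i$ is *positive* (*negative*) for $f$ if $f$ maps a neighbourhood of $x_i$ in $\Pi_k$ to a positive (negative) sector at $f(x_i)$, that is, if the differential of $f$ at $x_i$ maps the directions from $x_i$ to interior points of $\Pi_k$ into this sector. Call $f$ *admissible* if $x_0$ is positive and all other vertices are negative for $f$. For double points $a_0,\dots,a_{k-1}$ let $W_k^+(Y,a_0,\dots,a_{k-1})\subset\widetilde W_k(Y)$ be the set of classes of admissible immersions $f$ with $f(x_i)=a_i$ for all $i$. **Theorem 3.1.** For every double point $a$ of $Y$ the sum $$d(a)=\sum_{k\ge1}\ \sum_{(b_1,\dots,b_{k-1})}\ \sum_{f\in W_k^+(Y,a,b_1,\dots,b_{k-1})} b_1\cdots b_{k-1},$$ where $b_1,\dots,b_{k-1}$ range over the double points of $Y$, has only finitely many terms (that is, there are only finitely many triples $(k,(b_1,\dots,b_{k-1}),f)$ as indicated). Hence the definition of $d$ is sound: there is exactly one $\mathbf Z_2$-linear map $d$ from the free associative unital $\mathbf Z_2$-algebra $A_Y$ generated by the double points of $Y$ to itself that satisfies $d(xy)=d(x)y+x\,d(y)$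 for all $x,y\in A_Y$ and takes the above value at every double point $a$. -/

import Mathlib

open scoped ContDiff

noncomputable section

namespace Chekanov

/-- The value of the area form `dp ∧ dq` on a pair of vectors of the `(p, q)`-plane. -/
def cross (v w : ℝ × ℝ) : ℝ := v.1 * w.2 - v.2 * w.1

/-- A Legendrian link in `ℝ³ = {(p, q, u)}` with the contact form `du - p dq`: finitely many
disjoint smoothly embedded closed curves on which the form vanishes. The `i`-th component is
parametrized, with period one, by `t ↦ (p i t, q i t, u i t)`. -/
structure LegendrianLink where
  numComponents : ℕ
  p : Fin numComponents → ℝ → ℝ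
  q : Fin numComponents → ℝ → ℝ
  u : Fin numComponents → ℝ → ℝ
  smooth_p : ∀ i, ContDiff ℝ ∞ (p i)
  smooth_q : ∀ i, ContDiff ℝ ∞ (q i)
  smooth_u : ∀ i, ContDiff ℝ ∞ (u i)
  periodic_p : ∀ i, Function.Periodic (p i) 1
  periodic_q : ∀ i, Function.Periodic (q i) 1
  periodic_u : ∀ i, Function.Periodic (u i) 1
  regular : ∀ i t, deriv (p i) t ≠ 0 ∨ deriv (q i) t ≠ 0 ∨ deriv (u i) t ≠ 0
  embedded : ∀ i s j t, p i s = p j t → q i s = q j t → u i s = u j t →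
    i = j ∧ ∃ m : ℤ, t = s + m
  legendrian : ∀ i t, deriv (u i) t = p i t * deriv (q i) t

namespace LegendrianLink

variable (L : LegendrianLink)

/-- The projection of the `i`-th component to the `(p, q)`-plane. -/
def proj (i : Fin L.numComponents) (t : ℝ) : ℝ × ℝ := (L.p i t, L.q i t)

/-- The velocity vector of the projection of the `i`-th component. -/
def vel (i : Fin L.numComponents) (t : ℝ) : ℝ × ℝ := (deriv (L.p i) t, deriv (L.q i) t)

/-- The point set `Y = π(L)` of the diagram of the link. -/
def diagram : Set (ℝ × ℝ) := {z | ∃ i t, L.proj i t = z}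

/-- All self-intersections of the projection are transverse double points. Two points of the link
with the same projection are different exactly when their `u`-coordinates are different. -/
structure IsGeneric : Prop where
  no_triple : ∀ i r j s k t, L.proj i r = L.proj j s → L.proj j s = L.proj k t →
    L.u i r = L.u j s ∨ L.u j s = L.u k t ∨ L.u i r = L.u k t
  transverse : ∀ i s j t, L.proj i s = L.proj j t → L.u i s ≠ L.u j t →
    cross (L.vel i s) (L.vel j t) ≠ 0

/-- The double points of the diagram. -/
def DoublePoint : Type :=
  {a : ℝ × ℝ // ∃ i s j t, L.proj i s = a ∧ L.proj j t = a ∧ L.u i s ≠ L.u j t}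

/-- The tangent vectors at the point `a` that point into one of the two positive sectors: those
swept out when the lower branch is rotated counterclockwise to the upper branch. Such vectors are
the sums `x + y` where `x` is tangent to the lower branch, `y` is tangent to the upper branch and
`(x, y)` is a positively oriented basis. -/
def positiveSectors (a : ℝ × ℝ) : Set (ℝ × ℝ) :=
  {w | ∃ i s j t, L.proj i s = a ∧ L.proj j t = a ∧ L.u i s < L.u j t ∧
    ∃ α β : ℝ, w = α • L.vel i s + β • L.vel j t ∧
      0 < cross (α • L.vel i s) (β • L.vel j t)}

/-- The tangent vectors at the point `a` that point into one of the two negative sectors: those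
swept out when the upper branch is rotated counterclockwise to the lower branch. -/
def negativeSectors (a : ℝ × ℝ) : Set (ℝ × ℝ) :=
  {w | ∃ i s j t, L.proj i s = a ∧ L.proj j t = a ∧ L.u i s < L.u j t ∧
    ∃ α β : ℝ, w = α • L.vel i s + β • L.vel j t ∧
      cross (α • L.vel i s) (β • L.vel j t) < 0}

end LegendrianLink

/-- A curved convex polygon in the plane with `n + 1` vertices: a compact convex set whose boundary
consists of the smooth regular arcs `edge i` on `[0, 1]`, from the `i`-th vertex to the next one
(cyclically), run through counterclockwise, with an interior angle strictly between `0` and `π` at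
every vertex. -/
structure CurvedConvexPolygon (n : ℕ) where
  carrier : Set (ℝ × ℝ)
  edge : Fin (n + 1) → ℝ → ℝ × ℝ
  convex : Convex ℝ carrier
  compact : IsCompact carrier
  nonempty_interior : (interior carrier).Nonempty
  smooth_edge : ∀ i, ContDiff ℝ ∞ (edge i)
  regular_edge : ∀ i, ∀ t ∈ Set.Icc (0 : ℝ) 1, deriv (edge i) t ≠ 0
  edge_one : ∀ i, edge i 1 = edge (i + 1) 0
  edge_injective : ∀ i j, ∀ s ∈ Set.Ico (0 : ℝ) 1, ∀ t ∈ Set.Ico (0 : ℝ) 1,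
    edge i s = edge j t → i = j ∧ s = t
  frontier_eq : frontier carrier = ⋃ i, edge i '' Set.Icc (0 : ℝ) 1
  counterclockwise : ∀ i, ∀ t ∈ Set.Icc (0 : ℝ) 1, ∀ z ∈ carrier,
    0 ≤ cross (deriv (edge i) t) (z - edge i t)
  corner : ∀ i, 0 < cross (deriv (edge i) 1) (deriv (edge (i + 1)) 0)

namespace CurvedConvexPolygon

variable {n : ℕ} (P : CurvedConvexPolygon n)

/-- The vertices, numbered counterclockwise. -/
def vertex (i : Fin (n + 1)) : ℝ × ℝ := P.edge i 0

/-- `φ` is an orientation-preserving diffeomorphism of the polygon that fixes every vertex. A map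
on the (compact) polygon is smooth when it is the restriction of a smooth map of the plane; `φ` and
its inverse `ψ` are given by such extensions. -/
def IsReparametrization (φ : ℝ × ℝ → ℝ × ℝ) : Prop :=
  ∃ ψ : ℝ × ℝ → ℝ × ℝ, ContDiff ℝ ∞ φ ∧ ContDiff ℝ ∞ ψ ∧
    Set.MapsTo φ P.carrier P.carrier ∧ Set.MapsTo ψ P.carrier P.carrier ∧
    Set.LeftInvOn ψ φ P.carrier ∧ Set.RightInvOn ψ φ P.carrier ∧
    (∀ z ∈ P.carrier, 0 < (fderiv ℝ φ z).det) ∧ (∀ z ∈ P.carrier, 0 < (fderiv ℝ ψ z).det) ∧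
    (∀ i, φ (P.vertex i) = P.vertex i)

/-- The set `W_{n+1}(Y)` of smooth orientation-preserving immersions of the polygon into the plane
that send the boundary of the polygon to the diagram. An immersion is represented by a smooth
extension to the plane; the values outside the polygon are forgotten in `Unparametrized`. -/
def Immersion (L : LegendrianLink) : Type :=
  {f : ℝ × ℝ → ℝ × ℝ // ContDiff ℝ ∞ f ∧ (∀ z ∈ P.carrier, 0 < (fderiv ℝ f z).det) ∧
    Set.MapsTo f (frontier P.carrier) L.diagram}

/-- Two immersions are equivalent if they differ, as maps on the polygon, by an
orientation-preserving diffeomorphism that fixes the vertices. -/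
def immersionSetoid (L : LegendrianLink) : Setoid (P.Immersion L) where
  r f g := ∃ φ, P.IsReparametrization φ ∧ ∀ z ∈ P.carrier, g.1 z = f.1 (φ z)
  iseqv := by
    refine ⟨fun f => ⟨id, ⟨id, contDiff_id, contDiff_id, Set.mapsTo_id _, Set.mapsTo_id _,
      fun _ _ => rfl, fun _ _ => rfl, ?_, ?_, fun _ => rfl⟩, fun _ _ => rfl⟩, ?_, ?_⟩
    · intro z _
      simp [fderiv_id, ContinuousLinearMap.det]
    · intro z _
      simp [fderiv_id, ContinuousLinearMap.det]
    · rintro f g ⟨φ, ⟨ψ, h1, h2, h3, h4, h5, h6, h7, h8, h9⟩, h⟩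
      refine ⟨ψ, ⟨φ, h2, h1, h4, h3, h6, h5, h8, h7, fun i => ?_⟩, fun z hz => ?_⟩
      · have hi : P.vertex i ∈ P.carrier := by
          apply P.compact.isClosed.frontier_subset
          rw [P.frontier_eq]
          exact Set.mem_iUnion.2 ⟨i, 0, by simp, rfl⟩
        have := h5 hi
        rwa [h9 i] at this
      · rw [h _ (h4 hz), h6 hz]
    · rintro f g k ⟨φ, ⟨ψ, h1, h2, h3, h4, h5, h6, h7, h8, h9⟩, h⟩
        ⟨φ₁, ⟨ψ₁, k1, k2, k3, k4, k5, k6, k7, k8, k9⟩, k⟩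
      refine ⟨φ ∘ φ₁, ⟨ψ₁ ∘ ψ, h1.comp k1, k2.comp h2, h3.comp k3, k4.comp h4,
        fun z hz => ?_, fun z hz => ?_, fun z hz => ?_, fun z hz => ?_, fun i => ?_⟩,
        fun z hz => ?_⟩
      · simp [h5 (k3 hz), k5 hz]
      · simp [k6 (h4 hz), h6 hz]
      · rw [fderiv_comp z (h1.differentiable (by simp) _) (k1.differentiable (by simp) _)]
        have := mul_pos (h7 _ (k3 hz)) (k7 _ hz)
        simpa [ContinuousLinearMap.det, ContinuousLinearMap.coe_comp, LinearMap.det_comp] using this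
      · rw [fderiv_comp z (k2.differentiable (by simp) _) (h2.differentiable (by simp) _)]
        have := mul_pos (k8 _ (h4 hz)) (h8 _ hz)
        simpa [ContinuousLinearMap.det, ContinuousLinearMap.coe_comp, LinearMap.det_comp] using this
      · simp [k9, h9]
      · simp [k _ hz, h _ (k3 hz)]

/-- The set of non-parametrized immersions. -/
def Unparametrized (L : LegendrianLink) : Type := Quotient (P.immersionSetoid L)

/-- The `i`-th vertex is positive for `f`: near this vertex `f` maps the polygon to a positive
sector, that is, the differential maps the directions from the vertex into the polygon to vectors
that point into a positive sector. -/
def IsPositiveVertex {L : LegendrianLink} (f : P.Immersion L) (i : Fin (n + 1)) : Prop :=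
  ∀ z ∈ interior P.carrier,
    fderiv ℝ f.1 (P.vertex i) (z - P.vertex i) ∈ L.positiveSectors (f.1 (P.vertex i))

/-- The `i`-th vertex is negative for `f`. -/
def IsNegativeVertex {L : LegendrianLink} (f : P.Immersion L) (i : Fin (n + 1)) : Prop :=
  ∀ z ∈ interior P.carrier,
    fderiv ℝ f.1 (P.vertex i) (z - P.vertex i) ∈ L.negativeSectors (f.1 (P.vertex i))

/-- `f` is admissible: the initial vertex is positive and all other vertices are negative. -/
def IsAdmissible {L : LegendrianLink} (f : P.Immersion L) : Prop :=
  P.IsPositiveVertex f 0 ∧ ∀ i, i ≠ 0 → P.IsNegativeVertex f i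

/-- The set of admissible non-parametrized immersions that send the `i`-th vertex to the double
point `a i`, for every `i`. -/
def admissible (L : LegendrianLink) (a : Fin (n + 1) → L.DoublePoint) :
    Set (P.Unparametrized L) :=
  Quotient.mk (P.immersionSetoid L) ''
    {f | P.IsAdmissible f ∧ ∀ i, f.1 (P.vertex i) = (a i).1}

end CurvedConvexPolygon

/-- The free associative unital algebra over `ℤ/2` generated by the double points. -/
abbrev DiagramAlgebra (L : LegendrianLink) : Type := FreeAlgebra (ZMod 2) L.DoublePoint

/-- The index set of the sum that defines the differential of the double point `a`: the number
`n + 1` of vertices, the double points `w` to which the vertices other than the initial one are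
sent, and an admissible non-parametrized immersion with vertices at `a, w 0, …, w (n - 1)`. -/
def Term (L : LegendrianLink) (P : ∀ n, CurvedConvexPolygon n) (a : L.DoublePoint) : Type :=
  Σ n : ℕ, Σ w : Fin n → L.DoublePoint, ↥((P n).admissible L (Fin.cons a w))

/-- The summand of an index: the product of the generators `w 0, …, w (n - 1)` in this order. -/
def Term.monomial {L : LegendrianLink} {P : ∀ n, CurvedConvexPolygon n} {a : L.DoublePoint}
    (τ : Term L P a) : DiagramAlgebra L :=
  (List.ofFn fun i => FreeAlgebra.ι (ZMod 2) (τ.2.1 i)).prod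

end Chekanov

end

noncomputable section

namespace Chekanov

open Set Filter Topology MeasureTheory

/-! Since `du = p dq` on the link, the integral of `p dq` along the image of an edge is the change
of `u`. Around the boundary of an admissible immersion it is therefore the sum of the jumps of `u`
at the corners: the gap between the two branches at the positive vertex minus the gaps at the
negative vertices (`boundaryIntegral_eq`). By Stokes this integral is also the area of the immersed
polygon, hence nonnegative. So the gaps at the negative vertices add up to at most the gap at `a`.
There are finitely many double points, each with a positive gap; this bounds the number of vertices
(`Term.exists_length_le`) and leaves finitely many words.

For a fixed word the area is at most the gap at `a`. A path off the diagram lifts through an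
immersion, because the lift can leave the polygon only through its boundary, which lies over the
diagram. So the immersion has local inverses ("sections") over small patches, the closures of
connected regions off the diagram, and finitely many patches suffice for all immersions
(`exists_patchSystem`). Distinct sections over one patch have disjoint images, so the area bounds
their number (`card_mul_volume_le`).

Up to reparametrization an immersion is determined by finite data: which sections meet, and which
contain which vertices (`finite_image_mk`). If `f` and `g` have the same data, sending each point of
a section of `g` to the point of the matched section of `f` with the same parameter defines a
diffeomorphism. This is consistent because sections over two patches that agree at one point agree
on the whole overlap, even if the overlap is disconnected (`eqOn_inter_of_sections`).

The map `d` then exists and is unique because the algebra is free (`existsUnique_derivation`). -/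

/-- The inverse function theorem for smooth maps of the plane. -/
theorem exists_openPartialHomeomorph {f : ℝ × ℝ → ℝ × ℝ} (hf : ContDiff ℝ ∞ f) {z : ℝ × ℝ}
    (h : (fderiv ℝ f z).det ≠ 0) :
    ∃ e : OpenPartialHomeomorph (ℝ × ℝ) (ℝ × ℝ), (e : ℝ × ℝ → ℝ × ℝ) = f ∧ z ∈ e.source ∧
      ContDiffAt ℝ ∞ e.symm (f z) := by
  have hn : (∞ : WithTop ℕ∞) ≠ 0 := by simp
  set A := (fderiv ℝ f z).toContinuousLinearEquivOfDetNeZero h with hA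
  have hf' : HasFDerivAt f (A : ℝ × ℝ →L[ℝ] ℝ × ℝ) z := by
    rw [hA, ContinuousLinearMap.coe_toContinuousLinearEquivOfDetNeZero]
    exact (hf.differentiable (by simp) z).hasFDerivAt
  refine ⟨hf.contDiffAt.toOpenPartialHomeomorph f hf' hn, rfl,
    hf.contDiffAt.mem_toOpenPartialHomeomorph_source hf' hn, ?_⟩
  exact hf.contDiffAt.to_localInverse hf' hn

/-! ### Lifting maps through an immersion -/

section Lifts

variable {f : ℝ × ℝ → ℝ × ℝ} {C Y : Set (ℝ × ℝ)}

/-- The polygon is not open, but it lies in this open set when `f` is immersed on it; general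
results on lifts through local homeomorphisms apply there. -/
theorem isLocalHomeomorph_restrict (hf : ContDiff ℝ ∞ f) :
    IsLocalHomeomorph fun z : {z | (fderiv ℝ f z).det ≠ 0} => f z := by
  have hc : Continuous fun z => (fderiv ℝ f z).det :=
    ContinuousLinearMap.continuous_det.comp (hf.continuous_fderiv (by simp))
  have ho : IsOpen {z | (fderiv ℝ f z).det ≠ 0} := isOpen_ne.preimage hc
  rw [isLocalHomeomorph_iff_isLocalHomeomorphOn_univ]
  have h1 : IsLocalHomeomorphOn f {z | (fderiv ℝ f z).det ≠ 0} := by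
    refine IsLocalHomeomorphOn.mk _ _ fun z hz => ?_
    obtain ⟨e, he, hze, -⟩ := exists_openPartialHomeomorph hf hz
    exact ⟨e, hze, by rw [he]; exact eqOn_refl _ _⟩
  exact h1.comp ho.isOpenEmbedding_subtypeVal.isLocalHomeomorph.isLocalHomeomorphOn
    fun z _ => z.2

theorem eqOn_of_lifts (hf : ContDiff ℝ ∞ f) (hdet : ∀ z ∈ C, 0 < (fderiv ℝ f z).det)
    {X : Type*} [TopologicalSpace X] {S : Set X} (hS : IsPreconnected S) {α β : X → ℝ × ℝ}
    (hα : ContinuousOn α S) (hβ : ContinuousOn β S) (hαC : MapsTo α S C) (hβC : MapsTo β S C)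
    (h : ∀ x ∈ S, f (α x) = f (β x)) {x : X} (hx : x ∈ S) (hxx : α x = β x) : EqOn α β S := by
  have hloc := isLocalHomeomorph_restrict hf
  rw [isPreconnected_iff_preconnectedSpace] at hS
  let W := {z | (fderiv ℝ f z).det ≠ 0}
  let α' : S → W := fun s => ⟨α s, (hdet _ (hαC s.2)).ne'⟩
  let β' : S → W := fun s => ⟨β s, (hdet _ (hβC s.2)).ne'⟩
  have := (T2Space.isSeparatedMap (fun z : W => f z)).eq_of_comp_eq hloc.isLocallyInjective
    (g₁ := α') (g₂ := β') (Continuous.subtype_mk hα.domRestrict _)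
    (Continuous.subtype_mk hβ.domRestrict _) (funext fun s => h s s.2) ⟨x, hx⟩ (Subtype.ext hxx)
  intro s hs
  exact congrArg Subtype.val (congrFun this ⟨s, hs⟩)

/-- One leaves `C` continuously only through its frontier, and `f` maps the frontier into `Y`. Hence
a lift of something off `Y` is trapped. -/
theorem mapsTo_of_preconnected (hC : IsClosed C) (hfY : MapsTo f (frontier C) Y)
    {X : Type*} [TopologicalSpace X] {S : Set X} (hS : IsPreconnected S) {α : X → ℝ × ℝ}
    (hα : ContinuousOn α S) (hY : ∀ x ∈ S, f (α x) ∉ Y) {x : X} (hx : x ∈ S) (hxC : α x ∈ C) :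
    MapsTo α S (interior C) := by
  have h1 : ∀ x ∈ S, α x ∈ C → α x ∈ interior C := fun x hx h => by
    by_contra h'
    exact hY x hx (hfY (by rw [hC.frontier_eq]; exact ⟨h, h'⟩))
  have h2 := (hS.image α hα).subset_left_of_subset_union (u := interior C) (v := Cᶜ)
    isOpen_interior hC.isOpen_compl
    (disjoint_compl_right.mono_left interior_subset) ?_ ⟨α x, mem_image_of_mem _ hx, h1 x hx hxC⟩
  · exact mapsTo_iff_image_subset.2 h2
  · rintro _ ⟨y, hy, rfl⟩
    by_cases h : α y ∈ C
    · exact Or.inl (h1 y hy h)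
    · exact Or.inr h

/-- `Γ` is a lift through `f` into `C` of the restriction of the path `γ` to `[0, τ]`. -/
structure IsPathLift (f : ℝ × ℝ → ℝ × ℝ) (C : Set (ℝ × ℝ)) (γ : ℝ → ℝ × ℝ) (z : ℝ × ℝ) (τ : ℝ)
    (Γ : ℝ → ℝ × ℝ) : Prop where
  cont : ContinuousOn Γ (Icc 0 τ)
  mapsTo : MapsTo Γ (Icc 0 τ) C
  zero : Γ 0 = z
  lift : ∀ t ∈ Icc 0 τ, f (Γ t) = γ t

theorem IsPathLift.extend (hC : IsClosed C) (hfY : MapsTo f (frontier C) Y) {γ : ℝ → ℝ × ℝ}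
    (hγ : ContinuousOn γ (Icc 0 1)) (hγY : ∀ t ∈ Ico (0 : ℝ) 1, γ t ∉ Y)
    {z : ℝ × ℝ} {τ τ' : ℝ} {Γ : ℝ → ℝ × ℝ} (h : IsPathLift f C γ z τ Γ) (h0 : 0 ≤ τ) (h1 : τ < τ')
    (h2 : τ' ≤ 1) (e : OpenPartialHomeomorph (ℝ × ℝ) (ℝ × ℝ)) (he : (e : ℝ × ℝ → ℝ × ℝ) = f)
    (hes : Γ τ ∈ e.source) (het : MapsTo γ (Icc τ τ') e.target) :
    ∃ Γ', IsPathLift f C γ z τ' Γ' := by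
  have hτ : τ ∈ Icc 0 τ := ⟨h0, le_rfl⟩
  have hend : e.symm (γ τ) = Γ τ := by rw [← h.lift τ hτ, ← he, e.left_inv hes]
  have hc : ContinuousOn (fun t => e.symm (γ t)) (Icc τ τ') :=
    e.continuousOn_symm.comp (hγ.mono (Icc_subset_Icc h0 h2)) het
  have hm : MapsTo (fun t => e.symm (γ t)) (Ico τ τ') (interior C) := by
    refine mapsTo_of_preconnected hC hfY isPreconnected_Ico (hc.mono Ico_subset_Icc_self) ?_
      (x := τ) ⟨le_rfl, h1⟩ (by rw [hend]; exact h.mapsTo hτ)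
    intro t ht
    rw [← he, e.right_inv (het (Ico_subset_Icc_self ht))]
    exact hγY t ⟨h0.trans ht.1, ht.2.trans_le h2⟩
  -- At `τ'` the path may meet `Y` (if `τ' = 1`), so only closedness of `C` is available there.
  have hm' : MapsTo (fun t => e.symm (γ t)) (Icc τ τ') C := by
    have := (hm.mono_right interior_subset).closure_of_continuousOn
      (by rwa [closure_Ico h1.ne])
    rwa [closure_Ico h1.ne, hC.closure_eq] at this
  have hIcc : Icc 0 τ' = Icc 0 τ ∪ Icc τ τ' := (Icc_union_Icc_eq_Icc h0 h1.le).symm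
  refine ⟨fun t => if t ≤ τ then Γ t else e.symm (γ t), ?_, ?_, ?_, ?_⟩
  · rw [hIcc]
    refine ContinuousOn.union_of_isClosed ?_ ?_ isClosed_Icc isClosed_Icc
    · exact h.cont.congr fun t ht => if_pos ht.2
    · refine hc.congr fun t ht => ?_
      by_cases h' : t ≤ τ
      · have : t = τ := le_antisymm h' ht.1
        simp [this, hend]
      · simp [h']
  · intro t ht
    by_cases h' : t ≤ τ
    · simpa [h'] using h.mapsTo ⟨ht.1, h'⟩
    · simpa [h'] using hm' ⟨(not_le.1 h').le, ht.2⟩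
  · simp [h0, h.zero]
  · intro t ht
    by_cases h' : t ≤ τ
    · simpa [h'] using h.lift t ⟨ht.1, h'⟩
    · simp only [h', if_false]
      rw [← he, e.right_inv (het ⟨(not_le.1 h').le, ht.2⟩)]

/-- The set of times up to which a lift exists is closed because `C` is compact, and below time `1`
local inverses of `f` extend it to the right. -/
theorem exists_isPathLift (hC : IsCompact C) (hf : ContDiff ℝ ∞ f)
    (hdet : ∀ z ∈ C, 0 < (fderiv ℝ f z).det) (hfY : MapsTo f (frontier C) Y) {γ : ℝ → ℝ × ℝ}
    (hγ : ContinuousOn γ (Icc 0 1)) (hγY : ∀ t ∈ Ico (0 : ℝ) 1, γ t ∉ Y)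
    {z : ℝ × ℝ} (hz : z ∈ C) (hz0 : f z = γ 0) : ∃ Γ, IsPathLift f C γ z 1 Γ := by
  set A : Set ℝ := {τ | ∃ Γ, IsPathLift f C γ z τ Γ} with hA
  have h0 : (0 : ℝ) ∈ A := by
    refine ⟨fun _ => z, continuousOn_const, fun _ _ => hz, rfl, fun t ht => ?_⟩
    have : t = 0 := le_antisymm ht.2 ht.1
    rw [this, hz0]
  have hmono : ∀ τ ∈ A, ∀ τ' ≤ τ, τ' ∈ A := by
    rintro τ ⟨Γ, hΓ⟩ τ' h
    exact ⟨Γ, hΓ.cont.mono (Icc_subset_Icc_right h), hΓ.mapsTo.mono_left (Icc_subset_Icc_right h),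
      hΓ.zero, fun t ht => hΓ.lift t (Icc_subset_Icc_right h ht)⟩
  have hclosed : IsClosed (A ∩ Icc 0 1) := by
    rw [← isSeqClosed_iff_isClosed]
    intro τn τ hτn hlim
    have hτ : τ ∈ Icc (0 : ℝ) 1 := isClosed_Icc.mem_of_tendsto hlim (Eventually.of_forall
      fun n => (hτn n).2)
    refine ⟨?_, hτ⟩
    by_contra hnot
    have hlt : ∀ n, τn n < τ := fun n => by
      by_contra h
      exact hnot (hmono _ (hτn n).1 _ (not_lt.1 h))
    choose Γ hΓ using fun n => (hτn n).1
    have hmemC : ∀ n, Γ n (τn n) ∈ C := fun n => (hΓ n).mapsTo ⟨(hτn n).2.1, le_rfl⟩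
    -- The lifts `Γ n` need not be compatible: a local inverse at a limit point `w` of their ends
    -- extends a single one of them, late in the sequence, up to `τ`.
    obtain ⟨w, hw, φ, hφ, hwlim⟩ := hC.tendsto_subseq hmemC
    have hlim' : Tendsto (τn ∘ φ) atTop (𝓝 τ) := hlim.comp hφ.tendsto_atTop
    have hγlim : Tendsto (γ ∘ (τn ∘ φ)) atTop (𝓝 (γ τ)) :=
      (hγ τ hτ).tendsto.comp (tendsto_nhdsWithin_iff.2 ⟨hlim', Eventually.of_forall
        fun n => (hτn _).2⟩)
    have hfw : f w = γ τ := by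
      refine tendsto_nhds_unique ((hf.continuous.tendsto w).comp hwlim) (hγlim.congr fun n => ?_)
      exact ((hΓ (φ n)).lift _ ⟨(hτn _).2.1, le_rfl⟩).symm
    obtain ⟨e, he, hwe, -⟩ := exists_openPartialHomeomorph hf (hdet w hw).ne'
    have htar : ∀ᶠ t in 𝓝[Icc 0 1] τ, γ t ∈ e.target := by
      refine (hγ τ hτ).tendsto.eventually (e.open_target.mem_nhds ?_)
      rw [← hfw, ← he]
      exact e.map_source hwe
    obtain ⟨δ, hδ, hball⟩ := Metric.mem_nhdsWithin_iff.1 htar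
    have hev := (hlim'.eventually (Metric.ball_mem_nhds τ hδ)).and
      (hwlim.eventually (e.open_source.mem_nhds hwe))
    obtain ⟨n, hn1, hn2⟩ := hev.exists
    refine hnot ((hΓ (φ n)).extend hC.isClosed hfY hγ hγY (hτn _).2.1 (hlt _) hτ.2 e he hn2 ?_)
    intro t ht
    refine hball ⟨?_, (hτn _).2.1.trans ht.1, ht.2.trans hτ.2⟩
    have : dist (τn (φ n)) τ < δ := hn1
    rw [Real.dist_eq, abs_lt] at this
    rw [Metric.mem_ball, Real.dist_eq, abs_lt]
    constructor <;> linarith [ht.1, ht.2]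
  refine (hclosed.Icc_subset_of_forall_exists_gt h0 ?_ : Icc 0 1 ⊆ A) ⟨zero_le_one, le_rfl⟩
  rintro τ ⟨⟨Γ, hΓ⟩, hτ⟩ y hy
  have hτm : τ ∈ Icc 0 τ := ⟨hτ.1, le_rfl⟩
  obtain ⟨e, he, hwe, -⟩ := exists_openPartialHomeomorph hf (hdet _ (hΓ.mapsTo hτm)).ne'
  have htar : ∀ᶠ t in 𝓝[Icc 0 1] τ, γ t ∈ e.target := by
    refine (hγ τ (Ico_subset_Icc_self hτ)).tendsto.eventually (e.open_target.mem_nhds ?_)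
    rw [← hΓ.lift τ hτm, ← he]
    exact e.map_source hwe
  obtain ⟨δ, hδ, hball⟩ := Metric.mem_nhdsWithin_iff.1 htar
  have hy' : τ < y := hy
  set τ' := min (min y 1) (τ + δ / 2) with hτ'
  have h1 : τ < τ' := lt_min (lt_min hy' hτ.2) (by linarith)
  have h2 : τ' ≤ 1 := (min_le_left _ _).trans (min_le_right _ _)
  refine ⟨τ', ?_, h1, (min_le_left _ _).trans (min_le_left _ _)⟩
  refine hΓ.extend hC.isClosed hfY hγ hγY hτ.1 h1 h2 e he hwe fun t ht => ?_
  refine hball ⟨?_, hτ.1.trans ht.1, ht.2.trans h2⟩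
  have h3 : t ≤ τ + δ / 2 := ht.2.trans (min_le_right _ _)
  rw [Metric.mem_ball, Real.dist_eq, abs_lt]
  constructor <;> linarith [ht.1]

/-- A map of a convex set `D` that sends the half-open segments `[d₀, d)` off `Y` lifts through
`f`. -/
theorem exists_lift_of_convex (hC : IsCompact C) (hf : ContDiff ℝ ∞ f)
    (hdet : ∀ z ∈ C, 0 < (fderiv ℝ f z).det) (hfY : MapsTo f (frontier C) Y)
    {D : Set (ℝ × ℝ)} (hD : Convex ℝ D) {Ψ : ℝ × ℝ → ℝ × ℝ}
    (hΨ : ContinuousOn Ψ D) {d₀ z : ℝ × ℝ} (hd₀' : d₀ ∈ D)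
    (hΨY : ∀ d ∈ D, ∀ t ∈ Ico (0 : ℝ) 1, Ψ (d₀ + t • (d - d₀)) ∉ Y) (hz : z ∈ C) (hzd : f z = Ψ d₀) :
    ∃ σ : ℝ × ℝ → ℝ × ℝ, ContinuousOn σ D ∧ MapsTo σ D C ∧ (∀ d ∈ D, f (σ d) = Ψ d) ∧
      σ d₀ = z := by
  set ρ : ℝ × ℝ → ℝ → ℝ × ℝ := fun d t => d₀ + t • (d - d₀) with hρ
  have hρD : ∀ d ∈ D, ∀ t ∈ Icc (0 : ℝ) 1, ρ d t ∈ D := fun d hd t ht =>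
    hD.add_smul_sub_mem hd₀' hd ht
  have hρc : Continuous fun x : ℝ × (ℝ × ℝ) => ρ x.2 x.1 := by fun_prop
  have hpath : ∀ d : D, ∃ Γ, IsPathLift f C (fun t => Ψ (ρ d t)) z 1 Γ := by
    rintro ⟨d, hd⟩
    refine exists_isPathLift hC hf hdet hfY ?_ ?_ hz ?_
    · exact hΨ.comp (by fun_prop) fun t ht => hρD d hd t ht
    · exact fun t ht => hΨY d hd t ht
    · simp [hρ, hzd]
  choose Γ hΓ using hpath
  let W := {z | (fderiv ℝ f z).det ≠ 0}
  let g : unitInterval × D → W := fun x =>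
    ⟨Γ x.2 x.1, (hdet _ ((hΓ x.2).mapsTo x.1.2)).ne'⟩
  have hcont : Continuous fun x : unitInterval × D => Ψ (ρ x.2 x.1) :=
    hΨ.comp_continuous (hρc.comp (by fun_prop : Continuous fun x : unitInterval × D =>
      ((x.1 : ℝ), (x.2 : ℝ × ℝ)))) fun x => hρD _ x.2.2 _ x.1.2
  -- The lifts of the rays are chosen one by one; as they all start at `z`, the continuity theorem
  -- for lifts through a local homeomorphism makes them jointly continuous.
  have hg : Continuous g := by
    refine (isLocalHomeomorph_restrict hf).continuous_lift (T2Space.isSeparatedMap _)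
      ⟨_, hcont⟩ ?_ ?_ ?_
    · ext1 x
      exact (hΓ x.2).lift _ x.1.2
    · have : (fun d : D => g (0, d)) = fun _ => ⟨z, (hdet _ hz).ne'⟩ := by
        funext d
        exact Subtype.ext (hΓ d).zero
      rw [this]
      exact continuous_const
    · intro d
      exact Continuous.subtype_mk (hΓ d).cont.domRestrict _
  have hg1 : Continuous fun d : D => (g (1, d) : ℝ × ℝ) :=
    continuous_subtype_val.comp (hg.comp (by fun_prop))
  classical
  refine ⟨fun d => if h : d ∈ D then Γ ⟨d, h⟩ 1 else z, ?_, ?_, ?_, ?_⟩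
  · rw [continuousOn_iff_continuous_domRestrict]
    convert hg1 using 1
    funext d
    simp [g, domRestrict]
  · intro d hd
    simp only [hd, dif_pos]
    exact (hΓ _).mapsTo ⟨zero_le_one, le_rfl⟩
  · intro d hd
    simp only [hd, dif_pos]
    rw [(hΓ _).lift 1 ⟨zero_le_one, le_rfl⟩]
    simp [hρ]
  -- The ray to `d₀` is constant, so its lift is constant by uniqueness.
  · simp only [hd₀', dif_pos]
    rw [← (hΓ ⟨d₀, hd₀'⟩).zero]
    refine eqOn_of_lifts hf hdet isPreconnected_Icc (hΓ ⟨d₀, hd₀'⟩).cont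
      (continuousOn_const (c := z)) (hΓ _).mapsTo (fun _ _ => hz) (fun t ht => ?_)
      (x := 0) ⟨le_rfl, zero_le_one⟩ (hΓ _).zero ⟨zero_le_one, le_rfl⟩ |>.trans (hΓ _).zero.symm
    rw [(hΓ _).lift t ht, hzd]
    simp [hρ]

/-- A smooth map with positive Jacobian determinant on an open set has open image. -/
theorem isOpen_image_of_det (hf : ContDiff ℝ ∞ f) {O : Set (ℝ × ℝ)} (hO : IsOpen O)
    (hdet : ∀ z ∈ O, 0 < (fderiv ℝ f z).det) : IsOpen (f '' O) := by
  rw [isOpen_iff_mem_nhds]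
  rintro _ ⟨z, hz, rfl⟩
  obtain ⟨e, he, hze, -⟩ := exists_openPartialHomeomorph hf (hdet z hz).ne'
  rw [← he, ← e.map_nhds_eq hze]
  exact image_mem_map (hO.mem_nhds hz)

end Lifts

/-! ### Algebra of the area form -/

theorem cross_self (v : ℝ × ℝ) : cross v v = 0 := by simp only [cross]; ring

theorem cross_comm (v w : ℝ × ℝ) : cross v w = -cross w v := by simp only [cross]; ring

theorem cross_smul_left (c : ℝ) (v w : ℝ × ℝ) : cross (c • v) w = c * cross v w := by
  simp only [cross, Prod.smul_fst, Prod.smul_snd, smul_eq_mul]; ring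

theorem cross_smul_right (c : ℝ) (v w : ℝ × ℝ) : cross v (c • w) = c * cross v w := by
  simp only [cross, Prod.smul_fst, Prod.smul_snd, smul_eq_mul]; ring

theorem cross_rotate (v : ℝ × ℝ) : cross v (-v.2, v.1) = v.1 ^ 2 + v.2 ^ 2 := by
  simp only [cross]; ring

theorem cross_rotate_ne_zero {v : ℝ × ℝ} (hv : v ≠ 0) : cross v (-v.2, v.1) ≠ 0 := by
  rw [cross_rotate]
  intro h
  apply hv
  have h1 : v.1 = 0 := by nlinarith [sq_nonneg v.1, sq_nonneg v.2]
  have h2 : v.2 = 0 := by nlinarith [sq_nonneg v.1, sq_nonneg v.2]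
  exact Prod.ext h1 h2

/-! ### Local structure of the diagram -/

namespace LegendrianLink

variable (L : LegendrianLink)

/-- A velocity along the `u`-axis is impossible, since `p' = q' = 0` forces `u' = p q' = 0`. So the
projection is an immersion. -/
theorem vel_ne_zero (i : Fin L.numComponents) (t : ℝ) : L.vel i t ≠ 0 := by
  intro h
  have hp : deriv (L.p i) t = 0 := congrArg Prod.fst h
  have hq : deriv (L.q i) t = 0 := congrArg Prod.snd h
  have hu : deriv (L.u i) t = 0 := by rw [L.legendrian, hq, mul_zero]
  rcases L.regular i t with h | h | h <;> contradiction

theorem contDiff_proj (i : Fin L.numComponents) : ContDiff ℝ ∞ (L.proj i) :=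
  (L.smooth_p i).prodMk (L.smooth_q i)

theorem hasDerivAt_proj (i : Fin L.numComponents) (t : ℝ) :
    HasDerivAt (L.proj i) (L.vel i t) t :=
  ((L.smooth_p i).differentiable (by simp) t).hasDerivAt.prodMk
    ((L.smooth_q i).differentiable (by simp) t).hasDerivAt

theorem hasDerivAt_u (i : Fin L.numComponents) (t : ℝ) :
    HasDerivAt (L.u i) ((L.proj i t).1 * (L.vel i t).2) t := by
  have := ((L.smooth_u i).differentiable (by simp) t).hasDerivAt
  rwa [L.legendrian] at this

theorem proj_add_int (i : Fin L.numComponents) (t : ℝ) (m : ℤ) :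
    L.proj i (t + m) = L.proj i t := by
  have hp := (L.periodic_p i).int_mul m t
  have hq := (L.periodic_q i).int_mul m t
  simp only [mul_one] at hp hq
  simp [proj, hp, hq]

theorem u_add_int (i : Fin L.numComponents) (t : ℝ) (m : ℤ) : L.u i (t + m) = L.u i t := by
  simpa using (L.periodic_u i).int_mul m t

theorem vel_add_int (i : Fin L.numComponents) (t : ℝ) (m : ℤ) :
    L.vel i (t + m) = L.vel i t := by
  have h : HasDerivAt (fun s => L.proj i (s + m)) (L.vel i (t + m)) t :=
    (L.hasDerivAt_proj i (t + m)).comp_add_const t m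
  have h2 : (fun s => L.proj i (s + m)) = L.proj i := funext fun s => L.proj_add_int i s m
  rw [h2] at h
  exact h.unique (L.hasDerivAt_proj i t)

theorem eq_of_proj_eq_of_u_eq {i j : Fin L.numComponents} {s t : ℝ} (h : L.proj i s = L.proj j t)
    (hu : L.u i s = L.u j t) : i = j ∧ ∃ m : ℤ, t = s + m :=
  L.embedded i s j t (congrArg Prod.fst h) (congrArg Prod.snd h) hu

theorem vel_eq_of_proj_eq_of_u_eq {i j : Fin L.numComponents} {s t : ℝ}
    (h : L.proj i s = L.proj j t) (hu : L.u i s = L.u j t) : L.vel i s = L.vel j t := by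
  obtain ⟨rfl, m, rfl⟩ := L.eq_of_proj_eq_of_u_eq h hu
  exact (L.vel_add_int i s m).symm

theorem isCompact_diagram : IsCompact L.diagram := by
  have : L.diagram = ⋃ i, L.proj i '' Icc 0 1 := by
    ext z
    simp only [diagram, mem_ofPred, mem_iUnion, mem_image]
    refine exists_congr fun i => ⟨?_, fun ⟨t, _, h⟩ => ⟨t, h⟩⟩
    rintro ⟨t, rfl⟩
    refine ⟨Int.fract t, ⟨Int.fract_nonneg t, (Int.fract_lt_one t).le⟩, ?_⟩
    rw [← L.proj_add_int i (Int.fract t) ⌊t⌋, Int.fract_add_floor]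
  rw [this]
  exact isCompact_iUnion fun i => isCompact_Icc.image (L.contDiff_proj i).continuous

/-- By periodicity the parameters outside `O i` can be taken in `[0, 1]`; they project to a compact
set that misses `x`. -/
theorem eventually_mem_of_proj_eq {x : ℝ × ℝ} {O : Fin L.numComponents → Set ℝ}
    (hO : ∀ i, IsOpen (O i)) (hper : ∀ i, ∀ s ∈ O i, ∀ m : ℤ, s + m ∈ O i)
    (hx : ∀ i s, L.proj i s = x → s ∈ O i) :
    ∀ᶠ y in 𝓝 x, ∀ i s, L.proj i s = y → s ∈ O i := by
  rw [eventually_all]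
  intro i
  have hK : IsCompact (L.proj i '' (Icc 0 1 \ O i)) :=
    (isCompact_Icc.diff (hO i)).image (L.contDiff_proj i).continuous
  have hxK : x ∉ L.proj i '' (Icc 0 1 \ O i) := by
    rintro ⟨s, hs, h⟩
    exact hs.2 (hx i s h)
  filter_upwards [hK.isClosed.isOpen_compl.mem_nhds hxK] with y hy s hs
  have hfr : Int.fract s ∈ O i := by
    by_contra h
    refine hy ⟨Int.fract s, ⟨⟨Int.fract_nonneg s, (Int.fract_lt_one s).le⟩, h⟩, ?_⟩
    rw [← L.proj_add_int i (Int.fract s) ⌊s⌋, Int.fract_add_floor, hs]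
  have := hper i _ hfr ⌊s⌋
  rwa [Int.fract_add_floor] at this

/-- Two curves `γ₁`, `γ₂` that cross transversally at `x`, such that the diagram is near `x` the
union of those curves for which `b₁`, respectively `b₂` holds. -/
structure LocalModel (x : ℝ × ℝ) where
  γ₁ : ℝ → ℝ × ℝ
  γ₂ : ℝ → ℝ × ℝ
  υ₁ : ℝ → ℝ
  υ₂ : ℝ → ℝ
  b₁ : Prop
  b₂ : Prop
  smooth₁ : ContDiff ℝ ∞ γ₁
  smooth₂ : ContDiff ℝ ∞ γ₂
  zero₁ : γ₁ 0 = x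
  zero₂ : γ₂ 0 = x
  transverse : cross (deriv γ₁ 0) (deriv γ₂ 0) ≠ 0
  branch₁ : b₁ → ∃ i s₀, ∀ s, γ₁ s = L.proj i (s₀ + s) ∧ υ₁ s = L.u i (s₀ + s)
  branch₂ : b₂ → ∃ i s₀, ∀ s, γ₂ s = L.proj i (s₀ + s) ∧ υ₂ s = L.u i (s₀ + s)
  near : ∀ δ > 0, ∀ᶠ y in 𝓝 x, ∀ i s, L.proj i s = y →
    (b₁ ∧ ∃ s', |s'| < δ ∧ γ₁ s' = y ∧ υ₁ s' = L.u i s) ∨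
    (b₂ ∧ ∃ s', |s'| < δ ∧ γ₂ s' = y ∧ υ₂ s' = L.u i s)

/-- The parameters of the `i`-th component within `δ` of the point `s₀` of the `j`-th one. -/
def paramBall (j : Fin L.numComponents) (s₀ δ : ℝ) (i : Fin L.numComponents) : Set ℝ :=
  {s | i = j ∧ ∃ m : ℤ, |s - s₀ - m| < δ}

theorem isOpen_paramBall (j : Fin L.numComponents) (s₀ δ : ℝ) (i : Fin L.numComponents) :
    IsOpen (L.paramBall j s₀ δ i) := by
  have : L.paramBall j s₀ δ i = ⋃ (_ : i = j) (m : ℤ), {s | |s - s₀ - m| < δ} := by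
    ext s
    simp [paramBall]
  rw [this]
  refine isOpen_iUnion fun _ => isOpen_iUnion fun m => ?_
  exact isOpen_lt (by fun_prop) continuous_const

theorem add_int_mem_paramBall {j : Fin L.numComponents} {s₀ δ : ℝ} {i : Fin L.numComponents}
    {s : ℝ} (hs : s ∈ L.paramBall j s₀ δ i) (m : ℤ) : s + m ∈ L.paramBall j s₀ δ i := by
  obtain ⟨h, k, hk⟩ := hs
  refine ⟨h, k + m, ?_⟩
  push_cast
  convert hk using 2
  ring

theorem mem_paramBall_of_eq {j i : Fin L.numComponents} {s₀ s δ : ℝ} (hδ : 0 < δ)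
    (h : L.proj i s = L.proj j s₀) (hu : L.u i s = L.u j s₀) : s ∈ L.paramBall j s₀ δ i := by
  obtain ⟨hij, m, hm⟩ := L.eq_of_proj_eq_of_u_eq h.symm hu.symm
  exact ⟨hij.symm, m, by rw [hm]; simpa using hδ⟩

theorem exists_of_mem_paramBall {j i : Fin L.numComponents} {s₀ s δ : ℝ} {y : ℝ × ℝ}
    (h : s ∈ L.paramBall j s₀ δ i) (hy : L.proj i s = y) :
    ∃ s', |s'| < δ ∧ L.proj j (s₀ + s') = y ∧ L.u j (s₀ + s') = L.u i s := by
  obtain ⟨rfl, m, hm⟩ := h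
  refine ⟨s - s₀ - m, hm, ?_, ?_⟩
  · rw [← hy, ← L.proj_add_int i (s₀ + (s - s₀ - m)) m]
    congr 1
    ring
  · rw [← L.u_add_int i (s₀ + (s - s₀ - m)) m]
    congr 1
    ring

theorem hasDerivAt_proj_add (i : Fin L.numComponents) (s₀ s : ℝ) :
    HasDerivAt (fun s => L.proj i (s₀ + s)) (L.vel i (s₀ + s)) s :=
  (L.hasDerivAt_proj i (s₀ + s)).comp_const_add s₀ s

theorem contDiff_proj_add (i : Fin L.numComponents) (s₀ : ℝ) :
    ContDiff ℝ ∞ (fun s => L.proj i (s₀ + s)) :=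
  (L.contDiff_proj i).comp (by fun_prop)

theorem hasDerivAt_line (x v : ℝ × ℝ) (s : ℝ) : HasDerivAt (fun s : ℝ => x + s • v) v s := by
  simpa using ((hasDerivAt_id s).smul_const v).const_add x

variable {L}

/-- At most two branches pass through `x`. Missing branches are replaced by straight lines, marked
by a false `b₁` or `b₂`, so that points off the diagram, simple points and double points are treated
alike. -/
theorem exists_localModel (hL : L.IsGeneric) (x : ℝ × ℝ) : Nonempty (L.LocalModel x) := by
  by_cases h0 : ∃ i s, L.proj i s = x
  swap
  · push Not at h0
    refine ⟨⟨fun s => x + s • (1, 0), fun s => x + s • (0, 1), 0, 0, False, False, by fun_prop,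
      by fun_prop, by simp, by simp, ?_, False.elim, False.elim, fun δ _ => ?_⟩⟩
    · rw [(hasDerivAt_line x _ 0).deriv, (hasDerivAt_line x _ 0).deriv]
      simp [cross]
    · filter_upwards [L.eventually_mem_of_proj_eq (x := x) (O := fun _ => ∅) (fun _ => isOpen_empty)
        (fun _ _ h => h.elim) (fun i s h => (h0 i s h).elim)] with y hy i s hs
      exact (hy i s hs).elim
  obtain ⟨i₀, s₀, hx⟩ := h0
  by_cases h1 : ∃ i₁ s₁, L.proj i₁ s₁ = x ∧ L.u i₁ s₁ ≠ L.u i₀ s₀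
  · obtain ⟨i₁, s₁, hx₁, hu⟩ := h1
    refine ⟨⟨fun s => L.proj i₀ (s₀ + s), fun s => L.proj i₁ (s₁ + s), fun s => L.u i₀ (s₀ + s),
      fun s => L.u i₁ (s₁ + s), True, True, L.contDiff_proj_add _ _, L.contDiff_proj_add _ _,
      by simpa, by simpa, ?_, fun _ => ⟨i₀, s₀, fun s => ⟨rfl, rfl⟩⟩,
      fun _ => ⟨i₁, s₁, fun s => ⟨rfl, rfl⟩⟩, fun δ hδ => ?_⟩⟩
    · rw [(L.hasDerivAt_proj_add _ _ 0).deriv, (L.hasDerivAt_proj_add _ _ 0).deriv, add_zero,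
        add_zero]
      exact hL.transverse _ _ _ _ (hx.trans hx₁.symm) hu.symm
    · have hO : ∀ i s, L.proj i s = x → s ∈ L.paramBall i₀ s₀ δ i ∪ L.paramBall i₁ s₁ δ i := by
        intro i s h
        rcases hL.no_triple i s i₀ s₀ i₁ s₁ (h.trans hx.symm) (hx.trans hx₁.symm) with h' | h' | h'
        · exact Or.inl (L.mem_paramBall_of_eq hδ (h.trans hx.symm) h')
        · exact (hu h'.symm).elim
        · exact Or.inr (L.mem_paramBall_of_eq hδ (h.trans hx₁.symm) h')
      filter_upwards [L.eventually_mem_of_proj_eq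
        (fun i => (L.isOpen_paramBall _ _ _ _).union (L.isOpen_paramBall _ _ _ _))
        (fun i s hs m => hs.imp (fun h => L.add_int_mem_paramBall h m)
          (fun h => L.add_int_mem_paramBall h m)) hO] with y hy i s hs
      exact (hy i s hs).imp (fun h => ⟨trivial, L.exists_of_mem_paramBall h hs⟩)
        (fun h => ⟨trivial, L.exists_of_mem_paramBall h hs⟩)
  · push Not at h1
    set n : ℝ × ℝ := (-(L.vel i₀ s₀).2, (L.vel i₀ s₀).1)
    refine ⟨⟨fun s => L.proj i₀ (s₀ + s), fun s => x + s • n, fun s => L.u i₀ (s₀ + s),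
      0, True, False, L.contDiff_proj_add _ _, by fun_prop,
      by simpa, by simp, ?_, fun _ => ⟨i₀, s₀, fun s => ⟨rfl, rfl⟩⟩,
      False.elim, fun δ hδ => ?_⟩⟩
    · rw [(L.hasDerivAt_proj_add _ _ 0).deriv, (hasDerivAt_line x _ 0).deriv, add_zero]
      exact cross_rotate_ne_zero (L.vel_ne_zero _ _)
    · filter_upwards [L.eventually_mem_of_proj_eq (fun i => L.isOpen_paramBall i₀ s₀ δ i)
        (fun i s hs m => L.add_int_mem_paramBall hs m) (fun i s h =>
          L.mem_paramBall_of_eq hδ (h.trans hx.symm) (h1 i s h))] with y hy i s hs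
      exact Or.inl ⟨trivial, L.exists_of_mem_paramBall (hy i s hs) hs⟩

namespace LocalModel

variable {x : ℝ × ℝ} (M : L.LocalModel x)

/-- The map that sends the coordinate axes to the two curves. -/
def map (d : ℝ × ℝ) : ℝ × ℝ := M.γ₁ d.1 + M.γ₂ d.2 - x

theorem contDiff_map : ContDiff ℝ ∞ M.map :=
  ((M.smooth₁.comp contDiff_fst).add (M.smooth₂.comp contDiff_snd)).sub contDiff_const

theorem map_fst (s : ℝ) : M.map (s, 0) = M.γ₁ s := by simp [map, M.zero₂]

theorem map_snd (s : ℝ) : M.map (0, s) = M.γ₂ s := by simp [map, M.zero₁]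

theorem map_zero : M.map 0 = x := (M.map_fst 0).trans M.zero₁

theorem hasFDerivAt_map (d : ℝ × ℝ) : HasFDerivAt M.map
    ((ContinuousLinearMap.fst ℝ ℝ ℝ).smulRight (deriv M.γ₁ d.1) +
      (ContinuousLinearMap.snd ℝ ℝ ℝ).smulRight (deriv M.γ₂ d.2)) d := by
  have h1 := ((M.smooth₁.differentiable (by simp) d.1).hasDerivAt.hasFDerivAt).comp d
    (hasFDerivAt_fst (𝕜 := ℝ) (E := ℝ) (F := ℝ) (p := d))
  have h2 := ((M.smooth₂.differentiable (by simp) d.2).hasDerivAt.hasFDerivAt).comp d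
    (hasFDerivAt_snd (𝕜 := ℝ) (E := ℝ) (F := ℝ) (p := d))
  refine ((h1.add h2).sub_const x).congr_fderiv ?_
  ext <;> simp

end LocalModel

end LegendrianLink

/-- The determinant of an endomorphism of the plane. -/
theorem det_eq_cross (A : ℝ × ℝ →L[ℝ] ℝ × ℝ) : A.det = cross (A (1, 0)) (A (0, 1)) := by
  rw [ContinuousLinearMap.det, ← LinearMap.det_toMatrix (Module.Basis.finTwoProd ℝ),
    Matrix.det_fin_two]
  simp [LinearMap.toMatrix_apply, cross]
  ring

theorem cross_map (A : ℝ × ℝ →L[ℝ] ℝ × ℝ) (v w : ℝ × ℝ) :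
    cross (A v) (A w) = A.det * cross v w := by
  have h : ∀ v : ℝ × ℝ, A v = v.1 • A (1, 0) + v.2 • A (0, 1) := fun v => by
    rw [← map_smul, ← map_smul, ← map_add]
    simp
  rw [det_eq_cross, h v, h w]
  simp only [cross, Prod.fst_add, Prod.snd_add, Prod.smul_fst, Prod.smul_snd, smul_eq_mul]
  ring

namespace LegendrianLink.LocalModel

variable {L : LegendrianLink} {x : ℝ × ℝ} (M : L.LocalModel x)

theorem det_fderiv_map_zero : (fderiv ℝ M.map 0).det ≠ 0 := by
  rw [(M.hasFDerivAt_map 0).fderiv, det_eq_cross]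
  simpa using M.transverse

theorem exists_chart : ∃ e : OpenPartialHomeomorph (ℝ × ℝ) (ℝ × ℝ),
    (e : ℝ × ℝ → ℝ × ℝ) = M.map ∧ (0 : ℝ × ℝ) ∈ e.source ∧ ContDiffAt ℝ ∞ e.symm x := by
  obtain ⟨e, he, h0, hs⟩ := exists_openPartialHomeomorph M.contDiff_map M.det_fderiv_map_zero
  exact ⟨e, he, h0, by rwa [M.map_zero] at hs⟩

end LegendrianLink.LocalModel

namespace LegendrianLink

variable {L : LegendrianLink} {x : ℝ × ℝ}

/-- The local inverse of `M.map` straightens both curves to the coordinate axes. -/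
theorem LocalModel.exists_coords (M : L.LocalModel x) :
    ∃ e : OpenPartialHomeomorph (ℝ × ℝ) (ℝ × ℝ), (e : ℝ × ℝ → ℝ × ℝ) = M.map ∧
      (0 : ℝ × ℝ) ∈ e.source ∧ ContDiffAt ℝ ∞ e.symm x ∧
      ∃ δ > 0, Metric.closedBall 0 δ ⊆ e.source ∧ ∀ d ∈ Metric.closedBall 0 δ, ∀ i s,
        L.proj i s = M.map d → (M.b₁ ∧ d.2 = 0 ∧ M.υ₁ d.1 = L.u i s) ∨
          (M.b₂ ∧ d.1 = 0 ∧ M.υ₂ d.2 = L.u i s) := by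
  obtain ⟨e, he, h0, hs⟩ := M.exists_chart
  refine ⟨e, he, h0, hs, ?_⟩
  obtain ⟨δ₁, hδ₁, hball⟩ := Metric.nhds_basis_closedBall.mem_iff.1 (e.open_source.mem_nhds h0)
  have hev := M.contDiff_map.continuous.tendsto 0
  rw [M.map_zero] at hev
  obtain ⟨δ₂, hδ₂, hball₂⟩ := Metric.nhds_basis_closedBall.mem_iff.1
    (hev.eventually (M.near δ₁ hδ₁))
  refine ⟨min δ₁ δ₂, lt_min hδ₁ hδ₂,
    (Metric.closedBall_subset_closedBall (min_le_left _ _)).trans hball, fun d hd i s h => ?_⟩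
  have hd₁ : d ∈ e.source := hball (Metric.closedBall_subset_closedBall (min_le_left _ _) hd)
  have hd₂ := hball₂ (Metric.closedBall_subset_closedBall (min_le_right _ _) hd)
  -- Small parameters from `near` give a point on an axis with the same image as `d`; injectivity of
  -- the chart identifies the two.
  have key : ∀ d', ‖d'‖ < δ₁ → M.map d' = M.map d → d' = d := fun d' h1 h2 => by
    rw [← he] at h2
    exact e.injOn (hball (by simpa using h1.le)) hd₁ h2
  rcases hd₂ i s h with ⟨hb, s', h1, h2, h3⟩ | ⟨hb, s', h1, h2, h3⟩
  · have := key (s', 0) (by simpa [Prod.norm_def, hδ₁] using h1) (by rw [M.map_fst, h2])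
    exact Or.inl ⟨hb, by rw [← this], by rw [← this, h3]⟩
  · have := key (0, s') (by simpa [Prod.norm_def, hδ₁] using h1) (by rw [M.map_snd, h2])
    exact Or.inr ⟨hb, by rw [← this], by rw [← this, h3]⟩

/-! ### Square charts and their sectors -/

/-- `a` is a double point of the diagram. -/
def IsDouble (L : LegendrianLink) (a : ℝ × ℝ) : Prop :=
  ∃ i s j t, L.proj i s = a ∧ L.proj j t = a ∧ L.u i s ≠ L.u j t

/-- A chart around `x` whose domain contains the unit square, in which the diagram consists of
coordinate axes. -/
structure SquareChart (L : LegendrianLink) (x : ℝ × ℝ) where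
  e : OpenPartialHomeomorph (ℝ × ℝ) (ℝ × ℝ)
  cont : Continuous e
  sub : Metric.closedBall 0 1 ⊆ e.source
  zero : e 0 = x
  b₁ : Prop
  b₂ : Prop
  diagram : ∀ d ∈ Metric.closedBall 0 1, e d ∈ L.diagram ↔ (b₁ ∧ d.2 = 0) ∨ (b₂ ∧ d.1 = 0)
  double : ∀ d ∈ Metric.closedBall 0 1, L.IsDouble (e d) → d = 0

theorem exists_squareChart (hL : L.IsGeneric) (x : ℝ × ℝ) : Nonempty (L.SquareChart x) := by
  obtain ⟨M⟩ := exists_localModel hL x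
  obtain ⟨e, he, h0, -, δ, hδ, hball, hcoord⟩ := M.exists_coords
  have hmem : ∀ d ∈ Metric.closedBall (0 : ℝ × ℝ) 1, δ • d ∈ Metric.closedBall (0 : ℝ × ℝ) δ := by
    intro d hd
    rw [mem_closedBall_zero_iff] at hd ⊢
    rw [norm_smul, Real.norm_of_nonneg hδ.le]
    exact mul_le_of_le_one_right hδ.le hd
  let e' := (Homeomorph.smulOfNeZero (α := ℝ × ℝ) δ hδ.ne').toOpenPartialHomeomorph.trans e
  have he' : ∀ d, e' d = M.map (δ • d) := fun d => by
    rw [← he]; rfl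
  refine ⟨⟨e', ?_, fun d hd => ?_, ?_, M.b₁, M.b₂, fun d hd => ?_, fun d hd h => ?_⟩⟩
  · rw [show (e' : ℝ × ℝ → ℝ × ℝ) = fun d => M.map (δ • d) from funext he']
    exact M.contDiff_map.continuous.comp (by fun_prop)
  · exact ⟨trivial, hball (hmem d hd)⟩
  · rw [he', smul_zero, M.map_zero]
  · rw [he']
    constructor
    · rintro ⟨i, s, h⟩
      rcases hcoord _ (hmem d hd) i s h with ⟨hb, h, -⟩ | ⟨hb, h, -⟩
      · exact Or.inl ⟨hb, by simpa [hδ.ne'] using h⟩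
      · exact Or.inr ⟨hb, by simpa [hδ.ne'] using h⟩
    · rintro (⟨hb, h⟩ | ⟨hb, h⟩)
      · obtain ⟨i, s₀, hi⟩ := M.branch₁ hb
        refine ⟨i, s₀ + δ * d.1, ?_⟩
        rw [← (hi _).1, ← M.map_fst]
        congr 1
        ext <;> simp [h]
      · obtain ⟨i, s₀, hi⟩ := M.branch₂ hb
        refine ⟨i, s₀ + δ * d.2, ?_⟩
        rw [← (hi _).1, ← M.map_snd]
        congr 1
        ext <;> simp [h]
  · obtain ⟨i, s, j, t, h1, h2, hu⟩ := h
    rw [he'] at h1 h2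
    have h1' := hcoord _ (hmem d hd) i s h1
    have h2' := hcoord _ (hmem d hd) j t h2
    -- Different heights cannot both come from the same axis, so a double point lies on both.
    have : (δ • d).1 = 0 ∧ (δ • d).2 = 0 := by
      rcases h1' with ⟨-, h3, h4⟩ | ⟨-, h3, h4⟩ <;> rcases h2' with ⟨-, h5, h6⟩ | ⟨-, h5, h6⟩
      · exact (hu (h4.symm.trans h6)).elim
      · exact ⟨h5, h3⟩
      · exact ⟨h3, h5⟩
      · exact (hu (h4.symm.trans h6)).elim
    have h' : δ • d = 0 := Prod.ext this.1 this.2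
    simpa [hδ.ne'] using h'

namespace SquareChart

variable (c : L.SquareChart x)

/-- The open neighbourhood of `x` covered by the open unit square. -/
def dom : Set (ℝ × ℝ) := c.e '' Metric.ball 0 1

theorem ball_subset_source : Metric.ball 0 1 ⊆ c.e.source :=
  Metric.ball_subset_closedBall.trans c.sub

theorem isOpen_dom : IsOpen c.dom :=
  c.e.isOpen_image_of_subset_source Metric.isOpen_ball c.ball_subset_source

theorem mem_dom : x ∈ c.dom := ⟨0, by simp, c.zero⟩

theorem symm_mem {y : ℝ × ℝ} (hy : y ∈ c.dom) : c.e.symm y ∈ Metric.ball 0 1 := by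
  obtain ⟨d, hd, rfl⟩ := hy
  rwa [c.e.left_inv (c.ball_subset_source hd)]

theorem apply_symm {y : ℝ × ℝ} (hy : y ∈ c.dom) : c.e (c.e.symm y) = y := by
  obtain ⟨d, hd, rfl⟩ := hy
  rw [c.e.left_inv (c.ball_subset_source hd)]

theorem continuousOn_symm : ContinuousOn c.e.symm c.dom := by
  refine c.e.continuousOn_symm.mono ?_
  rintro _ ⟨d, hd, rfl⟩
  exact c.e.map_source (c.ball_subset_source hd)

/-- A closed quadrant, half or the whole of the unit square: the closure of a region cut out by
the axes that belong to the diagram. -/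
def sector (σ τ : ℝ) : Set (ℝ × ℝ) :=
  Metric.closedBall 0 1 ∩ {d | (c.b₂ → 0 ≤ σ * d.1) ∧ (c.b₁ → 0 ≤ τ * d.2)}

theorem convex_sector (σ τ : ℝ) : Convex ℝ (c.sector σ τ) := by
  refine (convex_closedBall _ _).inter ?_
  rintro d ⟨h1, h2⟩ d' ⟨h1', h2'⟩ a b ha hb -
  refine ⟨fun h => ?_, fun h => ?_⟩
  · have e1 := mul_nonneg ha (h1 h)
    have e2 := mul_nonneg hb (h1' h)
    simp only [Prod.fst_add, Prod.smul_fst, smul_eq_mul]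
    linarith
  · have e1 := mul_nonneg ha (h2 h)
    have e2 := mul_nonneg hb (h2' h)
    simp only [Prod.snd_add, Prod.smul_snd, smul_eq_mul]
    linarith

theorem isClosed_sector (σ τ : ℝ) : IsClosed (c.sector σ τ) := by
  refine Metric.isClosed_closedBall.inter ?_
  have h1 : IsClosed {d : ℝ × ℝ | c.b₂ → 0 ≤ σ * d.1} := by
    by_cases h : c.b₂
    · simpa [h] using isClosed_le continuous_const (by fun_prop)
    · simp [h]
  have h2 : IsClosed {d : ℝ × ℝ | c.b₁ → 0 ≤ τ * d.2} := by
    by_cases h : c.b₁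
    · simpa [h] using isClosed_le continuous_const (by fun_prop)
    · simp [h]
  exact h1.inter h2

/-- The sector inequalities are strict at `d₀` and weak at `d`, hence strict before the end of the
segment. This is the hypothesis on rays in `exists_lift_of_convex`. -/
theorem segment_sector_notMem {σ τ : ℝ} {d₀ d : ℝ × ℝ} (hd₀ : d₀ ∈ Metric.closedBall 0 1)
    (h₁ : c.b₂ → 0 < σ * d₀.1) (h₂ : c.b₁ → 0 < τ * d₀.2) (hd : d ∈ c.sector σ τ) {t : ℝ}
    (ht : t ∈ Ico (0 : ℝ) 1) : c.e (d₀ + t • (d - d₀)) ∉ L.diagram := by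
  have hmem := ((c.convex_sector σ τ).add_smul_sub_mem
    (x := d₀) ⟨hd₀, fun h => (h₁ h).le, fun h => (h₂ h).le⟩ hd (Ico_subset_Icc_self ht)).1
  rw [c.diagram _ hmem]
  have key : ∀ ρ a b : ℝ, 0 < ρ * a → 0 ≤ ρ * b → a + t * (b - a) ≠ 0 := by
    intro ρ a b h1 h2 h
    have h4 : ρ * (a + t * (b - a)) = (1 - t) * (ρ * a) + t * (ρ * b) := by ring
    have h5 : 0 < (1 - t) * (ρ * a) := mul_pos (by linarith [ht.2]) h1
    have h6 := mul_nonneg ht.1 h2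
    rw [h, mul_zero] at h4
    linarith
  rintro (⟨hb, h⟩ | ⟨hb, h⟩)
  · exact key τ d₀.2 d.2 (h₂ hb) (hd.2.2 hb) h
  · exact key σ d₀.1 d.1 (h₁ hb) (hd.2.1 hb) h

end SquareChart

end LegendrianLink

theorem exists_sign {X : Type*} [TopologicalSpace X] {S : Set X} (hS : IsPreconnected S)
    {φ : X → ℝ} (hφ : ContinuousOn φ S) (h : ∀ x ∈ S, φ x ≠ 0) :
    ∃ σ : ℝ, ∀ x ∈ S, 0 < σ * φ x := by
  have himg := (hS.image φ hφ).ordConnected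
  by_cases hpos : ∃ x ∈ S, 0 < φ x
  · obtain ⟨x, hx, hx0⟩ := hpos
    refine ⟨1, fun y hy => ?_⟩
    by_contra hneg
    obtain ⟨w, hw, hw0⟩ := himg.out (mem_image_of_mem φ hy) (mem_image_of_mem φ hx)
      ⟨by linarith, hx0.le⟩
    exact h w hw hw0
  · push Not at hpos
    exact ⟨-1, fun y hy => by linarith [lt_of_le_of_ne (hpos y hy) (h y hy)]⟩

/-! ### Sections over patches -/

/-- `s` is a continuous right inverse of `f` on `T` with values in `C`. -/
structure IsSectionOn (f : ℝ × ℝ → ℝ × ℝ) (C T : Set (ℝ × ℝ)) (s : ℝ × ℝ → ℝ × ℝ) : Prop where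
  cont : ContinuousOn s T
  mapsTo : MapsTo s T C
  right_inv : ∀ t ∈ T, f (s t) = t

/-- A smooth map with positive Jacobian determinant on a compact set that sends the frontier of
this set to `Y`. -/
structure IsImmersedIn (f : ℝ × ℝ → ℝ × ℝ) (C Y : Set (ℝ × ℝ)) : Prop where
  compact : IsCompact C
  smooth : ContDiff ℝ ∞ f
  det_pos : ∀ z ∈ C, 0 < (fderiv ℝ f z).det
  frontier : MapsTo f (frontier C) Y

namespace LegendrianLink

variable {L : LegendrianLink} {x : ℝ × ℝ}

namespace SquareChart

variable (c : L.SquareChart x)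

/-- A section over a small set whose interior avoids the diagram extends to a sector of a chart. -/
theorem exists_sector_lift {f : ℝ × ℝ → ℝ × ℝ} {C : Set (ℝ × ℝ)}
    (hf : IsImmersedIn f C L.diagram) {T S : Set (ℝ × ℝ)} (hTd : T ⊆ c.dom)
    (hT : IsPreconnected T) (hST : S ⊆ T) (hS : IsPreconnected S) (hne : S.Nonempty)
    (hTS : T ⊆ closure S) (hSY : ∀ y ∈ S, y ∉ L.diagram) {s : ℝ × ℝ → ℝ × ℝ}
    (hs : IsSectionOn f C T s) :
    ∃ (σ τ : ℝ) (A : ℝ × ℝ → ℝ × ℝ), ContinuousOn A (c.sector σ τ) ∧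
      MapsTo A (c.sector σ τ) C ∧ (∀ d ∈ c.sector σ τ, f (A d) = c.e d) ∧
      ∀ t ∈ T, c.e.symm t ∈ c.sector σ τ ∧ s t = A (c.e.symm t) := by
  have hcS : ContinuousOn c.e.symm S := c.continuousOn_symm.mono (hST.trans hTd)
  have hmem : ∀ y ∈ T, c.e.symm y ∈ Metric.closedBall 0 1 := fun y hy =>
    Metric.ball_subset_closedBall (c.symm_mem (hTd hy))
  have hnot : ∀ y ∈ S, ¬ ((c.b₁ ∧ (c.e.symm y).2 = 0) ∨ (c.b₂ ∧ (c.e.symm y).1 = 0)) := by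
    intro y hy
    rw [← c.diagram _ (hmem y (hST hy)), c.apply_symm (hTd (hST hy))]
    exact hSY y hy
  have h1 : ∃ σ : ℝ, ∀ y ∈ S, c.b₂ → 0 < σ * (c.e.symm y).1 := by
    by_cases hb : c.b₂
    · obtain ⟨σ, hσ⟩ := exists_sign hS (continuous_fst.comp_continuousOn hcS)
        (fun y hy h => hnot y hy (Or.inr ⟨hb, h⟩))
      exact ⟨σ, fun y hy _ => hσ y hy⟩
    · exact ⟨1, fun y _ h => (hb h).elim⟩
  have h2 : ∃ τ : ℝ, ∀ y ∈ S, c.b₁ → 0 < τ * (c.e.symm y).2 := by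
    by_cases hb : c.b₁
    · obtain ⟨σ, hσ⟩ := exists_sign hS (continuous_snd.comp_continuousOn hcS)
        (fun y hy h => hnot y hy (Or.inl ⟨hb, h⟩))
      exact ⟨σ, fun y hy _ => hσ y hy⟩
    · exact ⟨1, fun y _ h => (hb h).elim⟩
  obtain ⟨σ, hσ⟩ := h1
  obtain ⟨τ, hτ⟩ := h2
  -- The connected core has constant signs, and the patch lies in the closure of the core.
  have hTQ : MapsTo c.e.symm T (c.sector σ τ) := by
    have h3 : MapsTo c.e.symm S (c.sector σ τ) := fun y hy =>
      ⟨hmem y (hST hy), fun h => (hσ y hy h).le, fun h => (hτ y hy h).le⟩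
    intro y hy
    have h4 : ContinuousWithinAt c.e.symm S y :=
      (c.continuousOn_symm y (hTd hy)).mono (hST.trans hTd)
    have h5 := h4.mem_closure_image (hTS hy)
    rw [← (c.isClosed_sector σ τ).closure_eq]
    exact closure_mono (mapsTo_iff_image_subset.1 h3) h5
  -- The centre of the rays is taken in the core, where the inequalities are strict.
  obtain ⟨y, hy⟩ := hne
  have hyT := hST hy
  obtain ⟨A, hc, hm, hl, h0⟩ := exists_lift_of_convex hf.compact hf.smooth hf.det_pos hf.frontier
    (c.convex_sector σ τ) c.cont.continuousOn (hTQ hyT)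
    (fun d hd t ht => c.segment_sector_notMem (hmem y hyT) (hσ y hy) (hτ y hy) hd ht)
    (hs.mapsTo hyT) (by rw [hs.right_inv y hyT, c.apply_symm (hTd hyT)])
  refine ⟨σ, τ, A, hc, hm, hl, fun t ht => ⟨hTQ ht, ?_⟩⟩
  refine eqOn_of_lifts hf.smooth hf.det_pos hT hs.cont
    (hc.comp (c.continuousOn_symm.mono hTd) hTQ) hs.mapsTo (fun t ht => hm (hTQ ht)) ?_ hyT h0.symm
    ht
  intro t ht
  rw [hs.right_inv t ht, Function.comp_apply, hl _ (hTQ ht), c.apply_symm (hTd ht)]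

end SquareChart

/-- The closure of a connected region off the diagram. -/
structure IsPatch (L : LegendrianLink) (T S : Set (ℝ × ℝ)) : Prop where
  compact : IsCompact T
  preconnected : IsPreconnected T
  subset : S ⊆ T
  preconnected_core : IsPreconnected S
  nonempty : S.Nonempty
  isOpen : IsOpen S
  subset_closure : T ⊆ closure S
  notMem : ∀ y ∈ S, y ∉ L.diagram

/-- Uniqueness of lifts does not apply on `T ∩ T'`, which may be disconnected. But both sections
extend to sectors of one chart, and the intersection of two sectors is convex. -/
theorem SquareChart.eqOn_inter_of_sections (c : L.SquareChart x) {f : ℝ × ℝ → ℝ × ℝ}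
    {C : Set (ℝ × ℝ)} (hf : IsImmersedIn f C L.diagram) {T S T' S' : Set (ℝ × ℝ)}
    (hT : L.IsPatch T S) (hT' : L.IsPatch T' S') (hTd : T ⊆ c.dom) (hTd' : T' ⊆ c.dom)
    {s s' : ℝ × ℝ → ℝ × ℝ} (hs : IsSectionOn f C T s) (hs' : IsSectionOn f C T' s') {t : ℝ × ℝ}
    (ht : t ∈ T ∩ T') (htt : s t = s' t) : EqOn s s' (T ∩ T') := by
  obtain ⟨σ, τ, A, hA, hAC, hAf, hAs⟩ := c.exists_sector_lift hf hTd hT.preconnected hT.subset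
    hT.preconnected_core hT.nonempty hT.subset_closure hT.notMem hs
  obtain ⟨σ', τ', B, hB, hBC, hBf, hBs⟩ := c.exists_sector_lift hf hTd' hT'.preconnected hT'.subset
    hT'.preconnected_core hT'.nonempty hT'.subset_closure hT'.notMem hs'
  have := eqOn_of_lifts hf.smooth hf.det_pos
    ((c.convex_sector σ τ).inter (c.convex_sector σ' τ')).isPreconnected
    (hA.mono inter_subset_left) (hB.mono inter_subset_right) (hAC.mono_left inter_subset_left)
    (hBC.mono_left inter_subset_right) (fun d hd => by rw [hAf d hd.1, hBf d hd.2])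
    ⟨(hAs t ht.1).1, (hBs t ht.2).1⟩ (by rw [← (hAs t ht.1).2, ← (hBs t ht.2).2, htt])
  intro y hy
  rw [(hAs y hy.1).2, (hBs y hy.2).2]
  exact this ⟨(hAs y hy.1).1, (hBs y hy.2).1⟩

/-- Only the centre of a square chart can be a double point, and finitely many charts cover the
compact diagram. -/
theorem finite_isDouble (hL : L.IsGeneric) : {a | L.IsDouble a}.Finite := by
  let c := fun x => (exists_squareChart hL x).some
  obtain ⟨t, -, ht⟩ := L.isCompact_diagram.elim_nhds_subcover (fun x => (c x).dom)
    fun x _ => (c x).isOpen_dom.mem_nhds (c x).mem_dom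
  refine t.finite_toSet.subset fun a ha => ?_
  obtain ⟨i, s, _, _, h, -⟩ := id ha
  obtain ⟨x, hx, d, hd, hda⟩ := mem_iUnion₂.1 (ht ⟨i, s, h⟩)
  have := (c x).double d (Metric.ball_subset_closedBall hd) (by rwa [hda])
  rw [this, (c x).zero] at hda
  rwa [← hda]

theorem finite_doublePoint (hL : L.IsGeneric) : Finite L.DoublePoint :=
  (finite_isDouble hL).to_subtype

end LegendrianLink

/-- Maximum principle: a maximum of `‖f‖` above `R` would be attained at an interior point of `C`,
but the image of the interior is open and allows a push radially outwards. -/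
theorem IsImmersedIn.norm_le {f : ℝ × ℝ → ℝ × ℝ} {C Y : Set (ℝ × ℝ)} (hf : IsImmersedIn f C Y)
    {R : ℝ} (hY : Y ⊆ Metric.closedBall 0 R) (hR : 0 ≤ R) {z : ℝ × ℝ} (hz : z ∈ C) :
    f z ∈ Metric.closedBall 0 R := by
  obtain ⟨w, hw, hmax⟩ := hf.compact.exists_isMaxOn ⟨z, hz⟩ hf.smooth.continuous.norm.continuousOn
  have hle : ‖f z‖ ≤ ‖f w‖ := hmax hz
  suffices ‖f w‖ ≤ R from mem_closedBall_zero_iff.2 (hle.trans this)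
  by_contra hlt
  rw [not_le] at hlt
  have hwi : w ∈ interior C := by
    by_contra h
    have := hY (hf.frontier (by rw [hf.compact.isClosed.frontier_eq]; exact ⟨hw, h⟩))
    exact hlt.not_ge (mem_closedBall_zero_iff.1 this)
  have hopen := isOpen_image_of_det hf.smooth (isOpen_interior (s := C))
    fun z hz => hf.det_pos z (interior_subset hz)
  have hcont : ContinuousAt (fun t : ℝ => (1 + t) • f w) 0 := by fun_prop
  have hev : ∀ᶠ t : ℝ in 𝓝[>] 0, (1 + t) • f w ∈ f '' interior C := by
    refine nhdsWithin_le_nhds (hcont.eventually (hopen.mem_nhds ?_))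
    simpa using mem_image_of_mem f hwi
  obtain ⟨t, ⟨v, hv, hvt⟩, ht⟩ := (hev.and self_mem_nhdsWithin).exists
  have ht' : (0 : ℝ) < t := ht
  have h1 : ‖f v‖ ≤ ‖f w‖ := hmax (interior_subset hv)
  rw [hvt, norm_smul, Real.norm_of_nonneg (by linarith)] at h1
  nlinarith

/-! ### Square grids -/

/-- A cell of the square grid of mesh `1 / K`. -/
def gridCell (K : ℕ) (a : ℤ × ℤ) : Set (ℝ × ℝ) :=
  Icc ((a.1 : ℝ) / K) ((a.1 + 1) / K) ×ˢ Icc ((a.2 : ℝ) / K) ((a.2 + 1) / K)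

/-- The interior of a cell of the square grid. -/
def gridCore (K : ℕ) (a : ℤ × ℤ) : Set (ℝ × ℝ) :=
  Ioo ((a.1 : ℝ) / K) ((a.1 + 1) / K) ×ˢ Ioo ((a.2 : ℝ) / K) ((a.2 + 1) / K)

section Grid

variable {K : ℕ} (hK : 0 < K)

include hK in
theorem div_lt_succ_div (a : ℤ) : (a : ℝ) / K < (a + 1) / K := by
  have : (0 : ℝ) < K := by exact_mod_cast hK
  gcongr
  linarith

theorem convex_gridCell (a : ℤ × ℤ) : Convex ℝ (gridCell K a) :=
  (convex_Icc _ _).prod (convex_Icc _ _)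

theorem convex_gridCore (a : ℤ × ℤ) : Convex ℝ (gridCore K a) :=
  (convex_Ioo _ _).prod (convex_Ioo _ _)

theorem isCompact_gridCell (a : ℤ × ℤ) : IsCompact (gridCell K a) :=
  isCompact_Icc.prod isCompact_Icc

theorem isOpen_gridCore (a : ℤ × ℤ) : IsOpen (gridCore K a) := isOpen_Ioo.prod isOpen_Ioo

theorem gridCore_subset (a : ℤ × ℤ) : gridCore K a ⊆ gridCell K a :=
  prod_mono Ioo_subset_Icc_self Ioo_subset_Icc_self

include hK in
theorem nonempty_gridCore (a : ℤ × ℤ) : (gridCore K a).Nonempty :=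
  (nonempty_Ioo.2 (div_lt_succ_div hK _)).prod (nonempty_Ioo.2 (div_lt_succ_div hK _))

include hK in
theorem closure_gridCore (a : ℤ × ℤ) : closure (gridCore K a) = gridCell K a := by
  rw [gridCore, closure_prod_eq, closure_Ioo (div_lt_succ_div hK _).ne,
    closure_Ioo (div_lt_succ_div hK _).ne, gridCell]

include hK in
theorem gridCell_subset {a : ℤ × ℤ} (h₁ : a.1 ∈ Ico (-K : ℤ) K) (h₂ : a.2 ∈ Ico (-K : ℤ) K) :
    gridCell K a ⊆ Metric.closedBall 0 1 := by
  have hK' : (0 : ℝ) < K := by exact_mod_cast hK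
  have key : ∀ b : ℤ, b ∈ Ico (-K : ℤ) K → ∀ s ∈ Icc ((b : ℝ) / K) ((b + 1) / K), |s| ≤ 1 := by
    intro b hb s hs
    have h1 : (-K : ℝ) ≤ b := by exact_mod_cast hb.1
    have h2 : (b : ℝ) + 1 ≤ K := by exact_mod_cast hb.2
    rw [mem_Icc, div_le_iff₀ hK', le_div_iff₀ hK'] at hs
    rw [abs_le]
    constructor <;> nlinarith [hs.1, hs.2]
  intro d hd
  rw [mem_closedBall_zero_iff, Prod.norm_def]
  exact max_le (key _ h₁ _ hd.1) (key _ h₂ _ hd.2)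

include hK in
-- The axes are grid lines, so open cells avoid them and with them the diagram.
theorem ne_zero_of_mem_gridCore {a : ℤ × ℤ} {d : ℝ × ℝ} (hd : d ∈ gridCore K a) :
    d.1 ≠ 0 ∧ d.2 ≠ 0 := by
  have hK' : (0 : ℝ) < K := by exact_mod_cast hK
  have key : ∀ b : ℤ, ∀ s ∈ Ioo ((b : ℝ) / K) ((b + 1) / K), s ≠ 0 := by
    rintro b s hs rfl
    rw [mem_Ioo, div_lt_iff₀ hK', lt_div_iff₀ hK', zero_mul] at hs
    have h1 : b < 0 := by exact_mod_cast hs.1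
    have h2 : 0 < b + 1 := by exact_mod_cast hs.2
    omega
  exact ⟨key _ _ hd.1, key _ _ hd.2⟩

theorem dist_le_of_mem_gridCell {a : ℤ × ℤ} {d d' : ℝ × ℝ} (hd : d ∈ gridCell K a)
    (hd' : d' ∈ gridCell K a) : dist d d' ≤ 1 / K := by
  have key : ∀ b : ℤ, ∀ s ∈ Icc ((b : ℝ) / K) ((b + 1) / K),
      ∀ s' ∈ Icc ((b : ℝ) / K) ((b + 1) / K), dist s s' ≤ 1 / K := by
    intro b s hs s' hs'
    have := Real.dist_le_of_mem_Icc hs hs'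
    rwa [← sub_div, add_sub_cancel_left] at this
  rw [Prod.dist_eq]
  exact max_le (key _ _ hd.1 _ hd'.1) (key _ _ hd.2 _ hd'.2)

include hK in
/-- Every nonempty open subset of the unit square meets the interior of a cell. -/
theorem exists_mem_gridCore {O : Set (ℝ × ℝ)} (hO : IsOpen O) (hne : O.Nonempty)
    (hsub : O ⊆ Metric.ball 0 1) :
    ∃ a : ℤ × ℤ, a.1 ∈ Ico (-K : ℤ) K ∧ a.2 ∈ Ico (-K : ℤ) K ∧ ∃ d ∈ O, d ∈ gridCore K a := by
  have hK' : (0 : ℝ) < K := by exact_mod_cast hK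
  -- The points off all grid lines are dense, as each coordinate has to avoid only countably many
  -- values.
  set G : Set ℝ := (range fun a : ℤ => (a : ℝ) / K)ᶜ with hG
  have hGd : Dense G := (countable_range _).dense_compl ℝ
  obtain ⟨d, hdO, hd1, hd2⟩ := (hGd.prod hGd).inter_open_nonempty O hO hne
  have hd := hsub hdO
  rw [mem_ball_zero_iff, Prod.norm_def, max_lt_iff] at hd
  have key : ∀ s : ℝ, s ∈ G → |s| < 1 → ⌊K * s⌋ ∈ Ico (-K : ℤ) K ∧
      s ∈ Ioo ((⌊K * s⌋ : ℝ) / K) ((⌊K * s⌋ + 1) / K) := by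
    intro s hs h1
    rw [abs_lt] at h1
    refine ⟨⟨?_, ?_⟩, ?_, ?_⟩
    · rw [Int.le_floor]
      push_cast
      nlinarith
    · rw [Int.floor_lt]
      push_cast
      nlinarith
    · refine lt_of_le_of_ne ?_ fun h => hs ⟨_, h⟩
      rw [div_le_iff₀ hK', mul_comm]
      exact Int.floor_le _
    · rw [lt_div_iff₀ hK', mul_comm]
      exact Int.lt_floor_add_one _
  obtain ⟨h1, h2⟩ := key d.1 hd1 hd.1
  obtain ⟨h3, h4⟩ := key d.2 hd2 hd.2
  exact ⟨(⌊K * d.1⌋, ⌊K * d.2⌋), h1, h3, d, hdO, h2, h4⟩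

end Grid

/-! ### Patch systems -/

namespace LegendrianLink

variable {L : LegendrianLink} {x : ℝ × ℝ}

theorem SquareChart.isPatch (c : L.SquareChart x) {K : ℕ} (hK : 0 < K) {a : ℤ × ℤ}
    (h₁ : a.1 ∈ Ico (-K : ℤ) K) (h₂ : a.2 ∈ Ico (-K : ℤ) K) :
    L.IsPatch (c.e '' gridCell K a) (c.e '' gridCore K a) := by
  have hsub := gridCell_subset hK h₁ h₂
  refine ⟨(isCompact_gridCell a).image c.cont,
    (convex_gridCell a).isPreconnected.image _ c.cont.continuousOn,
    image_mono (gridCore_subset a), (convex_gridCore a).isPreconnected.image _ c.cont.continuousOn,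
    (nonempty_gridCore hK a).image _, c.e.isOpen_image_of_subset_source (isOpen_gridCore a)
      ((gridCore_subset a).trans (hsub.trans c.sub)), ?_, ?_⟩
  · rw [← closure_gridCore hK]
    exact image_closure_subset_closure_image c.cont
  · rintro _ ⟨d, hd, rfl⟩
    rw [c.diagram d (hsub (gridCore_subset a hd))]
    have := ne_zero_of_mem_gridCore hK hd
    tauto

/-- A ray from an interior point of the cell can leave the open cell, which is off the diagram, only
at its end; so the chart lifts along rays over the closed cell. -/
theorem SquareChart.exists_isSectionOn (c : L.SquareChart x) {K : ℕ} (hK : 0 < K) {a : ℤ × ℤ}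
    (h₁ : a.1 ∈ Ico (-K : ℤ) K) (h₂ : a.2 ∈ Ico (-K : ℤ) K) {f : ℝ × ℝ → ℝ × ℝ}
    {C : Set (ℝ × ℝ)} (hf : IsImmersedIn f C L.diagram) {z d : ℝ × ℝ} (hz : z ∈ C)
    (hd : d ∈ gridCore K a) (hzd : f z = c.e d) :
    ∃ s, IsSectionOn f C (c.e '' gridCell K a) s ∧ ∃ t ∈ c.e '' gridCell K a, s t = z := by
  have hsub := gridCell_subset hK h₁ h₂
  have hpatch := c.isPatch hK h₁ h₂
  have hint : gridCore K a ⊆ interior (gridCell K a) :=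
    interior_maximal (gridCore_subset a) (isOpen_gridCore a)
  have hint' : interior (gridCell K a) = gridCore K a := by
    rw [gridCell, interior_prod_eq, interior_Icc, interior_Icc, gridCore]
  have hseg : ∀ d' ∈ gridCell K a, ∀ t ∈ Ico (0 : ℝ) 1, c.e (d + t • (d' - d)) ∉ L.diagram := by
    intro d' hd' t ht
    refine hpatch.notMem _ (mem_image_of_mem _ ?_)
    rw [← hint']
    have := (convex_gridCell a).add_smul_sub_mem_interior hd' (hint hd) (t := 1 - t)
      ⟨by linarith [ht.2], by linarith [ht.1]⟩
    convert this using 1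
    module
  obtain ⟨σ, hσ, hσC, hσf, hσd⟩ := exists_lift_of_convex hf.compact hf.smooth hf.det_pos hf.frontier
    (convex_gridCell a) c.cont.continuousOn (gridCore_subset a hd) hseg hz hzd
  refine ⟨fun t => σ (c.e.symm t), ⟨?_, ?_, ?_⟩, c.e d, mem_image_of_mem _ (gridCore_subset a hd),
    ?_⟩
  · refine hσ.comp (c.e.continuousOn_symm.mono ?_) ?_
    · rintro _ ⟨d, hd, rfl⟩
      exact c.e.map_source (c.sub (hsub hd))
    · rintro _ ⟨d, hd, rfl⟩
      rwa [c.e.left_inv (c.sub (hsub hd))]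
  · rintro _ ⟨d, hd, rfl⟩
    simp only [c.e.left_inv (c.sub (hsub hd))]
    exact hσC hd
  · rintro _ ⟨d, hd, rfl⟩
    rw [c.e.left_inv (c.sub (hsub hd)), hσf d hd]
  · simp only [c.e.left_inv (c.sub (hsub (gridCore_subset a hd))), hσd]

/-- A finite system of patches over which an immersion bounded by the diagram has sections
through a dense set of points, and such that sections over two patches that agree at one point
agree on the intersection of the patches. -/
structure PatchSystem (L : LegendrianLink) where
  J : Type
  finite : Finite J
  T : J → Set (ℝ × ℝ)
  compact : ∀ j, IsCompact (T j)
  preconnected : ∀ j, IsPreconnected (T j)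
  interior_nonempty : ∀ j, (interior (T j)).Nonempty
  eqOn : ∀ f C, IsImmersedIn f C L.diagram → ∀ i j s s', IsSectionOn f C (T i) s →
    IsSectionOn f C (T j) s' → ∀ t ∈ T i ∩ T j, s t = s' t → EqOn s s' (T i ∩ T j)
  dense : ∀ f C, IsImmersedIn f C L.diagram → C ⊆ closure (interior C) →
    C ⊆ closure {z | ∃ j s, IsSectionOn f C (T j) s ∧ ∃ t ∈ T j, s t = z}

/-- Finitely many charts cover a ball that contains the images of all immersions. They are cut into
cells so small that two cells whose images meet lie in a common chart, as `eqOn_inter_of_sections`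
requires. -/
theorem exists_patchSystem (hL : L.IsGeneric) : Nonempty L.PatchSystem := by
  let c := fun x => (exists_squareChart hL x).some
  obtain ⟨R, hR0, hR⟩ : ∃ R ≥ 0, L.diagram ⊆ Metric.closedBall 0 R := by
    obtain ⟨R, hR⟩ := L.isCompact_diagram.isBounded.subset_closedBall 0
    exact ⟨max R 0, le_max_right _ _, hR.trans (Metric.closedBall_subset_closedBall
      (le_max_left _ _))⟩
  have hB : IsCompact (Metric.closedBall (0 : ℝ × ℝ) R) := isCompact_closedBall _ _
  obtain ⟨X, -, hX⟩ := hB.elim_nhds_subcover (fun x => (c x).dom)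
    fun x _ => (c x).isOpen_dom.mem_nhds (c x).mem_dom
  -- The common chart for two meeting patches may be any chart, not only one from the finite family
  -- `X`.
  obtain ⟨δ, hδ, hleb⟩ := lebesgue_number_lemma_of_metric hB (fun x => (c x).isOpen_dom)
    (fun y _ => mem_iUnion.2 ⟨y, (c y).mem_dom⟩)
  have hmesh : ∀ x, ∃ K : ℕ, 0 < K ∧ ∀ a : ℤ × ℤ, a.1 ∈ Ico (-K : ℤ) K → a.2 ∈ Ico (-K : ℤ) K →
      ∀ y ∈ (c x).e '' gridCell K a, ∀ y' ∈ (c x).e '' gridCell K a, dist y y' < δ := by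
    intro x
    have huc := (isCompact_closedBall (0 : ℝ × ℝ) 1).uniformContinuousOn_of_continuous
      (c x).cont.continuousOn
    obtain ⟨η, hη, hη'⟩ := Metric.uniformContinuousOn_iff.1 huc δ hδ
    obtain ⟨K, hK⟩ := exists_nat_one_div_lt hη
    refine ⟨K + 1, K.succ_pos, fun a h₁ h₂ => ?_⟩
    have hsub := gridCell_subset K.succ_pos h₁ h₂
    rintro _ ⟨d, hd, rfl⟩ _ ⟨d', hd', rfl⟩
    refine hη' d (hsub hd) d' (hsub hd') ?_
    have := dist_le_of_mem_gridCell hd hd'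
    push_cast at this
    exact this.trans_lt hK
  choose K hK hmesh using hmesh
  let J := Σ x : X, {a : ℤ × ℤ // a.1 ∈ Ico (-K x : ℤ) (K x) ∧ a.2 ∈ Ico (-K x : ℤ) (K x)}
  have hJ : Finite J := by
    have : ∀ x : X, Finite {a : ℤ × ℤ // a.1 ∈ Ico (-K x : ℤ) (K x) ∧ a.2 ∈ Ico (-K x : ℤ) (K x)} :=
      fun x => ((finite_Ico (-K x : ℤ) (K x)).prod (finite_Ico (-K x : ℤ) (K x))).to_subtype
    exact inferInstanceAs (Finite (Σ x : X, _))
  let T : J → Set (ℝ × ℝ) := fun j => (c j.1).e '' gridCell (K j.1) j.2.1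
  let S : J → Set (ℝ × ℝ) := fun j => (c j.1).e '' gridCore (K j.1) j.2.1
  have hP : ∀ j, L.IsPatch (T j) (S j) := fun j => (c j.1).isPatch (hK _) j.2.2.1 j.2.2.2
  refine ⟨⟨J, hJ, T, fun j => (hP j).compact, fun j => (hP j).preconnected,
    fun j => (hP j).nonempty.mono (interior_maximal (hP j).subset (hP j).isOpen), ?_, ?_⟩⟩
  · intro f C hf i j s s' hs hs' t ht htt
    have htB : t ∈ Metric.closedBall (0 : ℝ × ℝ) R := by
      have := hf.norm_le hR hR0 (hs.mapsTo ht.1)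
      rwa [hs.right_inv t ht.1] at this
    obtain ⟨y, hy⟩ := hleb t htB
    refine (c y).eqOn_inter_of_sections hf (hP i) (hP j) ?_ ?_ hs hs' ht htt
    · exact fun t' ht' => hy (hmesh i.1 _ i.2.2.1 i.2.2.2 t' ht' t ht.1)
    · exact fun t' ht' => hy (hmesh j.1 _ j.2.2.1 j.2.2.2 t' ht' t ht.2)
  · intro f C hf hC z hz
    rw [mem_closure_iff_nhds]
    intro U hU
    obtain ⟨x, hx, hxz⟩ := mem_iUnion₂.1 (hX (hf.norm_le hR hR0 hz))
    have hU' : U ∩ f ⁻¹' (c x).dom ∈ 𝓝 z := inter_mem hU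
      (hf.smooth.continuous.continuousAt.preimage_mem_nhds ((c x).isOpen_dom.mem_nhds hxz))
    obtain ⟨U', hU'sub, hU'o, hzU'⟩ := mem_nhds_iff.1 hU'
    obtain ⟨w, hwU, hwC⟩ := mem_closure_iff.1 (hC hz) U' hU'o hzU'
    -- An open piece of the interior near `z` has open image, which meets an open cell; the section
    -- over this cell is taken through a preimage in that piece.
    have himg : IsOpen (f '' (U' ∩ interior C)) := isOpen_image_of_det hf.smooth
      (hU'o.inter isOpen_interior) fun z hz => hf.det_pos z (interior_subset hz.2)
    obtain ⟨d, hd, hdw⟩ := (hU'sub hwU).2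
    obtain ⟨a, h₁, h₂, d', ⟨hd'O, hd'1⟩, hd'⟩ := exists_mem_gridCore (hK x)
      ((himg.preimage (c x).cont).inter Metric.isOpen_ball)
      ⟨d, ⟨w, ⟨hwU, hwC⟩, hdw.symm⟩, hd⟩ inter_subset_right
    obtain ⟨v, ⟨hvU, hvC⟩, hv⟩ := hd'O
    obtain ⟨s, hs, hst⟩ := (c x).exists_isSectionOn (hK x) h₁ h₂ hf (interior_subset hvC) hd' hv
    exact ⟨v, (hU'sub hvU).1, ⟨⟨x, hx⟩, a, h₁, h₂⟩, s, hs, hst⟩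

end LegendrianLink

/-! ### Reparametrizations from matched sections -/

theorem contDiffAt_symm_of_det {f : ℝ × ℝ → ℝ × ℝ} (hf : ContDiff ℝ ∞ f)
    {e : OpenPartialHomeomorph (ℝ × ℝ) (ℝ × ℝ)} (he : (e : ℝ × ℝ → ℝ × ℝ) = f) {w : ℝ × ℝ}
    (hw : w ∈ e.source) (h : (fderiv ℝ f w).det ≠ 0) : ContDiffAt ℝ ∞ e.symm (f w) := by
  have hw' : f w ∈ e.target := by rw [← he]; exact e.map_source hw
  have hsymm : e.symm (f w) = w := by rw [← he, e.left_inv hw]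
  refine e.contDiffAt_symm (f₀' := (fderiv ℝ f w).toContinuousLinearEquivOfDetNeZero h) hw' ?_ ?_
  · rw [hsymm, he, ContinuousLinearMap.coe_toContinuousLinearEquivOfDetNeZero]
    exact (hf.differentiable (by simp) w).hasFDerivAt
  · rw [hsymm, he]
    exact hf.contDiffAt

/-- A continuous map of a compact set `C` that intertwines two immersions is smooth, in the sense
that it extends to a smooth map of the plane. -/
theorem exists_contDiff_extension {f g φ : ℝ × ℝ → ℝ × ℝ} {C Y : Set (ℝ × ℝ)}
    (hf : IsImmersedIn f C Y) (hg : ContDiff ℝ ∞ g) (hφ : ContinuousOn φ C) (hφC : MapsTo φ C C)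
    (h : ∀ z ∈ C, f (φ z) = g z) : ∃ Φ, ContDiff ℝ ∞ Φ ∧ EqOn Φ φ C := by
  classical
  -- The value is prescribed on `C` and free elsewhere. These sets are convex, so local smooth
  -- choices can be glued by a partition of unity.
  let t : ℝ × ℝ → Set (ℝ × ℝ) := fun z => if z ∈ C then {φ z} else univ
  have ht : ∀ z, Convex ℝ (t z) := fun z => by
    by_cases hz : z ∈ C
    · simp [t, hz]
    · simpa [t, hz] using convex_univ
  have hloc : ∀ z : ℝ × ℝ, ∃ U ∈ 𝓝 z, ∃ G : ℝ × ℝ → ℝ × ℝ,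
      ContDiffOn ℝ ∞ G U ∧ ∀ y ∈ U, G y ∈ t y := by
    intro z
    by_cases hz : z ∈ C
    swap
    · refine ⟨Cᶜ, hf.compact.isClosed.isOpen_compl.mem_nhds hz, fun _ => 0, contDiffOn_const, ?_⟩
      intro y hy
      have hy' : y ∉ C := hy
      simp [t, hy']
    obtain ⟨e, he, hze, -⟩ :=
      exists_openPartialHomeomorph hf.smooth (hf.det_pos _ (hφC hz)).ne'
    have hdetc : Continuous fun z => (fderiv ℝ f z).det :=
      ContinuousLinearMap.continuous_det.comp (hf.smooth.continuous_fderiv (by simp))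
    set V := e.source ∩ {w | (fderiv ℝ f w).det ≠ 0} with hV
    have hVo : IsOpen V := e.open_source.inter (isOpen_ne.preimage hdetc)
    have hzV : φ z ∈ V := ⟨hze, (hf.det_pos _ (hφC hz)).ne'⟩
    have hfV : IsOpen (e '' V) := e.isOpen_image_of_subset_source hVo inter_subset_left
    obtain ⟨W, hW, hWV⟩ := mem_nhdsWithin_iff_exists_mem_nhds_inter.1
      ((hφ z hz).tendsto.eventually (hVo.mem_nhds hzV))
    -- The local choice is `g` followed by the inverse branch of `f` at `φ z`; by continuity `φ`
    -- takes its values on `W ∩ C` in that branch.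
    refine ⟨g ⁻¹' (e '' V) ∩ W, inter_mem (hg.continuous.continuousAt.preimage_mem_nhds
      (hfV.mem_nhds ?_)) hW, fun y => e.symm (g y), ?_, ?_⟩
    · rw [← h z hz, ← he]
      exact mem_image_of_mem _ hzV
    · rintro y ⟨⟨w, hw, hwy⟩, -⟩
      have h1 := contDiffAt_symm_of_det hf.smooth he hw.1 hw.2
      rw [← he, hwy] at h1
      exact (h1.comp y hg.contDiffAt).contDiffWithinAt
    · rintro y ⟨-, hyW⟩
      by_cases hy : y ∈ C
      · have : φ y ∈ V := hWV ⟨hyW, hy⟩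
        simp only [t, hy, if_true, mem_singleton_iff]
        rw [← h y hy, ← he, e.left_inv this.1]
      · simp [t, hy]
  obtain ⟨Φ, hΦ⟩ := exists_contMDiffMap_forall_mem_convex_of_local
    (modelWithCornersSelf ℝ (ℝ × ℝ)) (n := ⊤) ht fun z => by
      obtain ⟨U, hU, G, hG, hGt⟩ := hloc z
      exact ⟨U, hU, G, hG.contMDiffOn, hGt⟩
  refine ⟨Φ, Φ.contMDiff.contDiff, fun z hz => ?_⟩
  simpa [t, hz] using hΦ z

/-- The identity holds only on `C`, but derivatives within `C` are unique, so the chain rule applies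
and the determinants multiply. -/
theorem det_pos_of_comp {f g φ : ℝ × ℝ → ℝ × ℝ} {C Y : Set (ℝ × ℝ)} (hC : UniqueDiffOn ℝ C)
    (hf : IsImmersedIn f C Y) (hg : IsImmersedIn g C Y) (hφ : ContDiff ℝ ∞ φ)
    (hφC : MapsTo φ C C) (h : ∀ z ∈ C, f (φ z) = g z) {z : ℝ × ℝ} (hz : z ∈ C) :
    0 < (fderiv ℝ φ z).det := by
  have h1 : HasFDerivWithinAt (fun z => f (φ z)) ((fderiv ℝ f (φ z)).comp (fderiv ℝ φ z)) C z :=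
    ((hf.smooth.differentiable (by simp) _).hasFDerivAt.comp z
      (hφ.differentiable (by simp) z).hasFDerivAt).hasFDerivWithinAt
  have h2 : HasFDerivWithinAt (fun z => f (φ z)) (fderiv ℝ g z) C z :=
    (hg.smooth.differentiable (by simp) z).hasFDerivAt.hasFDerivWithinAt.congr h (h z hz)
  have h3 := (hC z hz).eq h1 h2
  have h4 := hg.det_pos z hz
  have h5 : (fderiv ℝ g z).det = (fderiv ℝ f (φ z)).det * (fderiv ℝ φ z).det := by
    rw [← h3]
    simp [ContinuousLinearMap.det, ContinuousLinearMap.toLinearMap_comp, LinearMap.det_comp]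
  rw [h5] at h4
  exact (pos_iff_pos_of_mul_pos h4).1 (hf.det_pos _ (hφC hz))

/-- The sections of `f` over `T`, normalized to vanish off `T`. -/
def sections (f : ℝ × ℝ → ℝ × ℝ) (C T : Set (ℝ × ℝ)) : Set (ℝ × ℝ → ℝ × ℝ) :=
  {s | IsSectionOn f C T s ∧ ∀ t ∉ T, s t = 0}

theorem IsSectionOn.indicator_mem {f : ℝ × ℝ → ℝ × ℝ} {C T : Set (ℝ × ℝ)} {s : ℝ × ℝ → ℝ × ℝ}
    (hs : IsSectionOn f C T s) : T.indicator s ∈ sections f C T := by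
  have h : EqOn (T.indicator s) s T := fun t ht => indicator_of_mem ht s
  refine ⟨⟨hs.cont.congr h, fun t ht => ?_, fun t ht => ?_⟩, fun t ht => indicator_of_notMem ht s⟩
  · rw [h ht]
    exact hs.mapsTo ht
  · rw [h ht]
    exact hs.right_inv t ht

namespace LegendrianLink.PatchSystem

variable {L : LegendrianLink} (S : L.PatchSystem)

/-- The images of finitely many sections over compact patches have a closed union, and this union is
dense in `C`. -/
theorem exists_section {f : ℝ × ℝ → ℝ × ℝ} {C : Set (ℝ × ℝ)} (hf : IsImmersedIn f C L.diagram)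
    (hC : C ⊆ closure (interior C)) (hfin : ∀ j, (sections f C (S.T j)).Finite) {z : ℝ × ℝ}
    (hz : z ∈ C) : ∃ j, ∃ s ∈ sections f C (S.T j), ∃ t ∈ S.T j, s t = z := by
  have := S.finite
  have hclosed : IsClosed (⋃ j, ⋃ s ∈ sections f C (S.T j), s '' S.T j) :=
    isClosed_iUnion_of_finite fun j => (hfin j).isClosed_biUnion fun s hs =>
      ((S.compact j).image_of_continuousOn hs.1.cont).isClosed
  have hsub := closure_minimal (s := {z | ∃ j s, IsSectionOn f C (S.T j) s ∧ ∃ t ∈ S.T j, s t = z})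
    (fun w hw => ?_) hclosed
  · simpa only [mem_iUnion, mem_image, exists_prop] using hsub (S.dense f C hf hC hz)
  · obtain ⟨j, s, hs, t, ht, rfl⟩ := hw
    simp only [mem_iUnion]
    exact ⟨j, _, hs.indicator_mem, t, ht, indicator_of_mem ht s⟩

/-- A correspondence between the sections of `g` and the sections of `f` that respects
coincidences. -/
structure Matching (f g : ℝ × ℝ → ℝ × ℝ) (C : Set (ℝ × ℝ)) (X : Set (ℝ × ℝ))
    (M : S.J → (ℝ × ℝ → ℝ × ℝ) → (ℝ × ℝ → ℝ × ℝ) → Prop) : Prop where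
  left : ∀ j s s', M j s s' → s ∈ sections g C (S.T j)
  right : ∀ j s s', M j s s' → s' ∈ sections f C (S.T j)
  exists_right : ∀ j, ∀ s ∈ sections g C (S.T j), ∃ s', M j s s'
  agree : ∀ i j s s' r r', M i s s' → M j r r' → (∃ t ∈ S.T i ∩ S.T j, s t = r t) →
    ∃ t ∈ S.T i ∩ S.T j, s' t = r' t
  marked : ∀ j s s', M j s s' → ∀ x ∈ X, (∃ t ∈ S.T j, s t = x) → ∃ t ∈ S.T j, s' t = x

/-- The map is glued from the pieces `s t ↦ s' t`; consistency comes from `agree` together with the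
overlap property of the patch system. -/
theorem Matching.exists_map {S : L.PatchSystem} {f g : ℝ × ℝ → ℝ × ℝ} {C X : Set (ℝ × ℝ)}
    {M : S.J → (ℝ × ℝ → ℝ × ℝ) → (ℝ × ℝ → ℝ × ℝ) → Prop} (hM : S.Matching f g C X M)
    (hf : IsImmersedIn f C L.diagram) (hg : IsImmersedIn g C L.diagram)
    (hC : C ⊆ closure (interior C)) (hfin : ∀ j, (sections g C (S.T j)).Finite)
    (hX : X ⊆ C) (hfg : ∀ x ∈ X, f x = g x) :
    ∃ φ : ℝ × ℝ → ℝ × ℝ, ContDiff ℝ ∞ φ ∧ MapsTo φ C C ∧ (∀ z ∈ C, f (φ z) = g z) ∧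
      (∀ x ∈ X, φ x = x) ∧ ∀ j s s', M j s s' → ∀ t ∈ S.T j, φ (s t) = s' t := by
  have := S.finite
  have hex : ∀ z, ∃ w, ∀ j s s', M j s s' → ∀ t ∈ S.T j, s t = z → s' t = w := by
    intro z
    by_cases h : ∃ j s s', M j s s' ∧ ∃ t ∈ S.T j, s t = z
    · obtain ⟨j, s, s', hj, t, ht, hst⟩ := h
      refine ⟨s' t, fun i r r' hi t' ht' hrt => ?_⟩
      have htt : t' = t := by
        rw [← (hM.left _ _ _ hi).1.right_inv t' ht', ← (hM.left _ _ _ hj).1.right_inv t ht, hst, hrt]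
      subst htt
      -- The coincidence supplied for `f` is at some `t₀`, possibly different from `t'`; `S.eqOn`
      -- transports it.
      obtain ⟨t₀, ht₀, h₀⟩ := hM.agree i j r r' s s' hi hj ⟨t', ⟨ht', ht⟩, hrt.trans hst.symm⟩
      exact S.eqOn f C hf i j r' s' (hM.right _ _ _ hi).1 (hM.right _ _ _ hj).1 t₀ ht₀ h₀ ⟨ht', ht⟩
    · exact ⟨0, fun j s s' hj t ht hst => (h ⟨j, s, s', hj, t, ht, hst⟩).elim⟩
  choose φ hφ using hex
  have hφs : ∀ j s s', M j s s' → ∀ t ∈ S.T j, φ (s t) = s' t := fun j s s' hj t ht =>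
    (hφ (s t) j s s' hj t ht rfl).symm
  have hcov : ∀ z ∈ C, ∃ j s s', M j s s' ∧ ∃ t ∈ S.T j, s t = z := by
    intro z hz
    obtain ⟨j, s, hs, h⟩ := S.exists_section hg hC hfin hz
    obtain ⟨s', hs'⟩ := hM.exists_right j s hs
    exact ⟨j, s, s', hs', h⟩
  have hφC : MapsTo φ C C := by
    intro z hz
    obtain ⟨j, s, s', hj, t, ht, rfl⟩ := hcov z hz
    rw [hφs j s s' hj t ht]
    exact (hM.right _ _ _ hj).1.mapsTo ht
  have hfφ : ∀ z ∈ C, f (φ z) = g z := by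
    intro z hz
    obtain ⟨j, s, s', hj, t, ht, rfl⟩ := hcov z hz
    rw [hφs j s s' hj t ht, (hM.right _ _ _ hj).1.right_inv t ht,
      (hM.left _ _ _ hj).1.right_inv t ht]
  -- On each of the finitely many closed pieces `s '' T` the map is `s' ∘ g`.
  have hcont : ContinuousOn φ C := by
    let I := Σ j, sections g C (S.T j)
    have : Finite I := by
      have := fun j => (hfin j).to_subtype
      exact inferInstanceAs (Finite (Σ j, _))
    let F : I → Set (ℝ × ℝ) := fun x => x.2.1 '' S.T x.1
    have hF : ContinuousOn φ (⋃ x, F x) := by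
      refine (locallyFinite_of_finite F).continuousOn_iUnion (fun x => ?_) fun x => ?_
      · exact ((S.compact _).image_of_continuousOn x.2.2.1.cont).isClosed
      · obtain ⟨s', hs'⟩ := hM.exists_right x.1 x.2.1 x.2.2
        have h1 : ContinuousOn (fun z => s' (g z)) (F x) := by
          refine (hM.right _ _ _ hs').1.cont.comp hg.smooth.continuous.continuousOn ?_
          rintro _ ⟨t, ht, rfl⟩
          rwa [x.2.2.1.right_inv t ht]
        refine h1.congr ?_
        rintro _ ⟨t, ht, rfl⟩
        simp only [hφs _ _ _ hs' t ht, x.2.2.1.right_inv t ht]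
    refine hF.mono fun z hz => ?_
    obtain ⟨j, s, hs, t, ht, h⟩ := S.exists_section hg hC hfin hz
    exact mem_iUnion.2 ⟨⟨j, s, hs⟩, t, ht, h⟩
  obtain ⟨Φ, hΦ, hΦφ⟩ := exists_contDiff_extension hf hg.smooth hcont hφC hfφ
  refine ⟨Φ, hΦ, fun z hz => by rw [hΦφ hz]; exact hφC hz, fun z hz => by rw [hΦφ hz, hfφ z hz],
    fun x hx => ?_, fun j s s' hj t ht => ?_⟩
  · rw [hΦφ (hX hx)]
    obtain ⟨j, s, s', hj, t, ht, hst⟩ := hcov x (hX hx)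
    obtain ⟨t', ht', h'⟩ := hM.marked j s s' hj x hx ⟨t, ht, hst⟩
    have h1 : t = g x := by rw [← hst, (hM.left _ _ _ hj).1.right_inv t ht]
    have h2 : t' = f x := by rw [← h', (hM.right _ _ _ hj).1.right_inv t' ht']
    have h3 : t = t' := by rw [h1, h2, hfg x hx]
    rw [← hst, hφs j s s' hj t ht, hst, h3, h']
  · rw [hΦφ ((hM.left _ _ _ hj).1.mapsTo ht), hφs j s s' hj t ht]

end LegendrianLink.PatchSystem

/-! ### Finitely many classes when the numbers of sections are bounded -/

namespace CurvedConvexPolygon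

variable {n : ℕ} {P : CurvedConvexPolygon n} {L : LegendrianLink}

theorem isImmersedIn (f : P.Immersion L) : IsImmersedIn f.1 P.carrier L.diagram :=
  ⟨P.compact, f.2.1, f.2.2.1, f.2.2.2⟩

variable (P) in
theorem edge_mem_frontier (i : Fin (n + 1)) {t : ℝ} (ht : t ∈ Icc (0 : ℝ) 1) :
    P.edge i t ∈ frontier P.carrier := by
  rw [P.frontier_eq]
  exact mem_iUnion.2 ⟨i, t, ht, rfl⟩

variable (P) in
theorem edge_mem (i : Fin (n + 1)) {t : ℝ} (ht : t ∈ Icc (0 : ℝ) 1) : P.edge i t ∈ P.carrier :=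
  P.compact.isClosed.frontier_subset (P.edge_mem_frontier i ht)

variable (P) in
theorem vertex_mem (i : Fin (n + 1)) : P.vertex i ∈ P.carrier :=
  P.edge_mem i ⟨le_rfl, zero_le_one⟩

variable (P) in
theorem subset_closure_interior : P.carrier ⊆ closure (interior P.carrier) := by
  rw [P.convex.closure_interior_eq_closure_of_nonempty_interior P.nonempty_interior]
  exact subset_closure

/-- The maps of the matching and of its reverse are mutually inverse, since every point lies on a
section and `s t ↦ s' t ↦ s t`. -/
theorem equiv_of_matching {S : L.PatchSystem} {f g : P.Immersion L}
    {M : S.J → (ℝ × ℝ → ℝ × ℝ) → (ℝ × ℝ → ℝ × ℝ) → Prop}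
    (hM : S.Matching f.1 g.1 P.carrier (range P.vertex) M)
    (hM' : S.Matching g.1 f.1 P.carrier (range P.vertex) fun j s s' => M j s' s)
    (hf : ∀ j, (sections f.1 P.carrier (S.T j)).Finite)
    (hg : ∀ j, (sections g.1 P.carrier (S.T j)).Finite)
    (hfg : ∀ i, f.1 (P.vertex i) = g.1 (P.vertex i)) : P.immersionSetoid L f g := by
  have hX : range P.vertex ⊆ P.carrier := range_subset_iff.2 P.vertex_mem
  have hC := P.subset_closure_interior
  have hu := uniqueDiffOn_convex P.convex P.nonempty_interior
  obtain ⟨φ, hφ, hφC, hφf, hφv, hφM⟩ := hM.exists_map (isImmersedIn f) (isImmersedIn g) hC hg hX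
    (by rintro _ ⟨i, rfl⟩; exact hfg i)
  obtain ⟨ψ, hψ, hψC, hψf, -, hψM⟩ := hM'.exists_map (isImmersedIn g) (isImmersedIn f) hC hf hX
    (by rintro _ ⟨i, rfl⟩; exact (hfg i).symm)
  refine ⟨φ, ⟨ψ, hφ, hψ, hφC, hψC, fun z hz => ?_, fun z hz => ?_,
    fun z hz => det_pos_of_comp hu (isImmersedIn f) (isImmersedIn g) hφ hφC hφf hz,
    fun z hz => det_pos_of_comp hu (isImmersedIn g) (isImmersedIn f) hψ hψC hψf hz,
    fun i => hφv _ (mem_range_self i)⟩, fun z hz => (hφf z hz).symm⟩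
  · obtain ⟨j, s, hs, t, ht, rfl⟩ := S.exists_section (isImmersedIn g) hC hg hz
    obtain ⟨s', hs'⟩ := hM.exists_right j s hs
    rw [hφM j s s' hs' t ht, hψM j s' s hs' t ht]
  · obtain ⟨j, s, hs, t, ht, rfl⟩ := S.exists_section (isImmersedIn f) hC hf hz
    obtain ⟨s', hs'⟩ := hM'.exists_right j s hs
    rw [hψM j s s' hs' t ht, hφM j s' s hs' t ht]

/-- Immersions with prescribed images of the vertices that have boundedly many sections over every
patch form finitely many classes. -/
theorem finite_image_mk (S : L.PatchSystem) {N : ℕ} {F : Set (P.Immersion L)}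
    {a : Fin (n + 1) → ℝ × ℝ} (ha : ∀ f ∈ F, ∀ i, f.1 (P.vertex i) = a i)
    (hN : ∀ f ∈ F, ∀ j, (sections f.1 P.carrier (S.T j)).Finite ∧
      (sections f.1 P.carrier (S.T j)).ncard ≤ N) :
    (Quotient.mk (P.immersionSetoid L) '' F).Finite := by
  have := S.finite
  have hemb : ∀ f : F, ∀ j, ∃ ι : sections f.1.1 P.carrier (S.T j) → Fin N,
      Function.Injective ι := by
    intro f j
    obtain ⟨h1, h2⟩ := hN f f.2 j
    have := h1.fintype
    rw [← Nat.card_coe_set_eq, Nat.card_eq_fintype_card] at h2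
    obtain ⟨e⟩ := Function.Embedding.nonempty_of_card_le (α := sections f.1.1 P.carrier (S.T j))
      (β := Fin N) (by simpa using h2)
    exact ⟨e, e.injective⟩
  choose ι hι using hemb
  let lab : F → S.J → (ℝ × ℝ → ℝ × ℝ) → Fin N → Prop := fun f j s k =>
    ∃ hs : s ∈ sections f.1.1 P.carrier (S.T j), ι f j ⟨s, hs⟩ = k
  have hlab : ∀ {f j s s' k}, lab f j s k → lab f j s' k → s = s' := by
    rintro f j s s' k ⟨h1, h2⟩ ⟨h3, h4⟩
    exact congrArg Subtype.val (hι f j (h2.trans h4.symm))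
  -- A finite invariant for an arbitrary numbering of the sections: the labels in use, the pairs of
  -- labelled sections that meet, and the vertices on each labelled section. Equal codes match
  -- sections with equal labels.
  let code : F → Set (S.J × Fin N) × Set ((S.J × Fin N) × (S.J × Fin N)) ×
      Set (Fin (n + 1) × S.J × Fin N) := fun f =>
    ({x | ∃ s, lab f x.1 s x.2},
      {x | ∃ s r, lab f x.1.1 s x.1.2 ∧ lab f x.2.1 r x.2.2 ∧
        ∃ t ∈ S.T x.1.1 ∩ S.T x.2.1, s t = r t},
      {x | ∃ s, lab f x.2.1 s x.2.2 ∧ ∃ t ∈ S.T x.2.1, s t = P.vertex x.1})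
  have hmatch : ∀ f g, code f = code g → S.Matching f.1.1 g.1.1 P.carrier (range P.vertex)
      fun j s s' => ∃ k, lab g j s k ∧ lab f j s' k := by
    intro f g h
    have hc1 := congrArg Prod.fst h
    have hc2 := congrArg (fun x => x.2.1) h
    have hc3 := congrArg (fun x => x.2.2) h
    refine ⟨?_, ?_, ?_, ?_, ?_⟩
    · rintro j s s' ⟨k, ⟨hs, -⟩, -⟩
      exact hs
    · rintro j s s' ⟨k, -, ⟨hs, -⟩⟩
      exact hs
    · intro j s hs
      have : (j, ι g j ⟨s, hs⟩) ∈ (code f).1 := by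
        rw [hc1]
        exact ⟨s, hs, rfl⟩
      obtain ⟨s', hs'⟩ := this
      exact ⟨s', _, ⟨hs, rfl⟩, hs'⟩
    · rintro i j s s' r r' ⟨k, hk, hk'⟩ ⟨l, hl, hl'⟩ ht
      have : ((i, k), (j, l)) ∈ (code f).2.1 := by
        rw [show (code f).2.1 = (code g).2.1 from hc2]
        exact ⟨s, r, hk, hl, ht⟩
      obtain ⟨s₀, r₀, h1, h2, h3⟩ := this
      rwa [hlab h1 hk', hlab h2 hl'] at h3
    · rintro j s s' ⟨k, hk, hk'⟩ _ ⟨m, rfl⟩ ht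
      have : (m, j, k) ∈ (code f).2.2 := by
        rw [show (code f).2.2 = (code g).2.2 from hc3]
        exact ⟨s, hk, ht⟩
      obtain ⟨s₀, h1, h3⟩ := this
      rwa [hlab h1 hk'] at h3
  have hcode : ∀ f g, code f = code g →
      Quotient.mk (P.immersionSetoid L) f.1 = Quotient.mk (P.immersionSetoid L) g.1 := by
    intro f g h
    refine Quotient.sound (equiv_of_matching (hmatch f g h) ?_ (fun j => (hN f f.2 j).1)
      (fun j => (hN g g.2 j).1) fun i => ?_)
    · convert hmatch g f h.symm using 5
      exact funext fun k => propext and_comm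
    · rw [ha f f.2, ha g g.2]
  have hrep : ∀ q : Quotient.mk (P.immersionSetoid L) '' F, ∃ f : F,
      Quotient.mk (P.immersionSetoid L) f.1 = q.1 := by
    rintro ⟨_, f, hf, rfl⟩
    exact ⟨⟨f, hf⟩, rfl⟩
  choose rep hrep using hrep
  refine Set.finite_coe_iff.1 ?_
  exact Finite.of_injective (fun q => code (rep q)) fun q q' h => Subtype.ext (by
    rw [← hrep q, ← hrep q', hcode _ _ h])

end CurvedConvexPolygon

/-! ### Stokes' formula and the area bound -/

section Green

variable {G : ℝ × ℝ → ℝ × ℝ}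

/-- The pull-back under `G` of the form `p dq`, evaluated on a constant vector field. -/
def pullbackPdq (G : ℝ × ℝ → ℝ × ℝ) (v x : ℝ × ℝ) : ℝ := (G x).1 * (fderiv ℝ G x v).2

theorem continuous_pullbackPdq (hG : ContDiff ℝ ∞ G) (v : ℝ × ℝ) :
    Continuous (pullbackPdq G v) := by
  have h := hG.continuous_fderiv (by simp)
  have h' := hG.continuous
  unfold pullbackPdq
  fun_prop

theorem hasFDerivAt_pullbackPdq (hG : ContDiff ℝ ∞ G) (v x : ℝ × ℝ) :
    ∃ A : ℝ × ℝ →L[ℝ] ℝ, HasFDerivAt (pullbackPdq G v) A x ∧ ∀ w, A w =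
      (G x).1 * (fderiv ℝ (fderiv ℝ G) x w v).2 + (fderiv ℝ G x w).1 * (fderiv ℝ G x v).2 := by
  have h1 : HasFDerivAt G (fderiv ℝ G x) x := (hG.differentiable (by simp) x).hasFDerivAt
  have h2 : HasFDerivAt (fderiv ℝ G) (fderiv ℝ (fderiv ℝ G) x) x :=
    ((hG.fderiv_right (m := ∞) (by simp)).differentiable (by simp) x).hasFDerivAt
  have h3 := h1.fst.mul (h2.clm_apply (hasFDerivAt_const v x)).snd
  refine ⟨_, h3, fun w => ?_⟩
  simp
  ring

/-- The divergence theorem for the pull-back of `p dq`: the second derivatives cancel by symmetry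
and leave the Jacobian determinant. -/
theorem setIntegral_det_fderiv (hG : ContDiff ℝ ∞ G) :
    ∫ x in Icc (0 : ℝ × ℝ) 1, (fderiv ℝ G x).det =
      (∫ y in (0 : ℝ)..1, pullbackPdq G (0, 1) (1, y)) -
        (∫ y in (0 : ℝ)..1, pullbackPdq G (0, 1) (0, y)) -
      (∫ x in (0 : ℝ)..1, pullbackPdq G (1, 0) (x, 1)) +
        ∫ x in (0 : ℝ)..1, pullbackPdq G (1, 0) (x, 0) := by
  choose A hA hA' using fun x => hasFDerivAt_pullbackPdq hG (0, 1) x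
  choose B hB hB' using fun x => hasFDerivAt_pullbackPdq hG (1, 0) x
  have key : ∀ x, A x (1, 0) + (-B x) (0, 1) = (fderiv ℝ G x).det := by
    intro x
    have hsymm : fderiv ℝ (fderiv ℝ G) x (1, 0) (0, 1) = fderiv ℝ (fderiv ℝ G) x (0, 1) (1, 0) :=
      (hG.contDiffAt.isSymmSndFDerivAt (by
        simpa using WithTop.coe_le_coe.2 (le_top : (2 : ℕ∞) ≤ ⊤))) _ _
    rw [neg_apply, hA', hB', det_eq_cross, hsymm, cross]
    ring
  have hdet : Continuous fun x => (fderiv ℝ G x).det :=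
    ContinuousLinearMap.continuous_det.comp (hG.continuous_fderiv (by simp))
  have := integral_divergence_prod_Icc_of_hasFDerivAt_of_le (pullbackPdq G (0, 1))
    (fun x => -pullbackPdq G (1, 0) x) A (fun x => -B x) 0 1 zero_le_one
    (continuous_pullbackPdq hG _).continuousOn (continuous_pullbackPdq hG _).neg.continuousOn
    (fun x _ => hA x) (fun x _ => (hB x).neg)
    (by simp only [key]; exact hdet.continuousOn.integrableOn_compact isCompact_Icc)
  simp only [key] at this
  rw [this]
  simp only [Prod.fst_zero, Prod.fst_one, Prod.snd_zero, Prod.snd_one,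
    intervalIntegral.integral_neg]
  ring

end Green

namespace CurvedConvexPolygon

variable {n : ℕ} (P : CurvedConvexPolygon n)

/-- The polar parametrization with centre `c` of the sector over the `i`-th edge. -/
def polar (c : ℝ × ℝ) (i : Fin (n + 1)) (x : ℝ × ℝ) : ℝ × ℝ := c + x.1 • (P.edge i x.2 - c)

theorem contDiff_polar (c : ℝ × ℝ) (i : Fin (n + 1)) : ContDiff ℝ ∞ (P.polar c i) := by
  have := P.smooth_edge i
  unfold polar
  fun_prop

theorem polar_mem {c : ℝ × ℝ} (hc : c ∈ P.carrier) (i : Fin (n + 1)) {x : ℝ × ℝ}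
    (hx : x ∈ Icc (0 : ℝ × ℝ) 1) : P.polar c i x ∈ P.carrier :=
  P.convex.add_smul_sub_mem hc (P.edge_mem i ⟨hx.1.2, hx.2.2⟩) ⟨hx.1.1, hx.2.1⟩

/-- The farthest point of the polygon on the ray from `c` through `z` lies on the frontier, hence on
an edge, and `z` lies between it and `c`. -/
theorem exists_polar_eq (c : ℝ × ℝ) {z : ℝ × ℝ} (hz : z ∈ P.carrier) :
    ∃ i, ∃ x ∈ Icc (0 : ℝ × ℝ) 1, P.polar c i x = z := by
  by_cases hzc : z = c
  · exact ⟨0, 0, ⟨le_rfl, zero_le_one⟩, by simp [polar, hzc]⟩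
  have hcl : Continuous fun ρ : ℝ => c + ρ • (z - c) := by fun_prop
  set R := (fun ρ : ℝ => c + ρ • (z - c)) ⁻¹' P.carrier with hR
  have hnorm : 0 < ‖z - c‖ := norm_pos_iff.2 (sub_ne_zero.2 hzc)
  have hRc : IsCompact R := by
    refine Metric.isCompact_of_isClosed_isBounded (P.compact.isClosed.preimage hcl) ?_
    obtain ⟨B, hB⟩ := P.compact.isBounded.exists_norm_le
    refine isBounded_iff_forall_norm_le.2 ⟨(B + ‖c‖) / ‖z - c‖, fun ρ hρ => ?_⟩
    rw [le_div_iff₀ hnorm, ← norm_smul]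
    have h1 := hB _ hρ
    have h2 := norm_sub_le (c + ρ • (z - c)) c
    rw [add_sub_cancel_left] at h2
    linarith
  have h1 : (1 : ℝ) ∈ R := by simpa [hR] using hz
  obtain ⟨ρ, hρ, hmax⟩ := hRc.exists_isMaxOn ⟨1, h1⟩ continuousOn_id
  have hρ1 : 1 ≤ ρ := hmax h1
  have hfr : c + ρ • (z - c) ∈ frontier P.carrier := by
    rw [P.compact.isClosed.frontier_eq]
    refine ⟨hρ, fun hint => ?_⟩
    have hev : ∀ᶠ ρ' in 𝓝[>] ρ, c + ρ' • (z - c) ∈ interior P.carrier :=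
      nhdsWithin_le_nhds (hcl.continuousAt.eventually (isOpen_interior.mem_nhds hint))
    obtain ⟨ρ', h2, h3⟩ := (hev.and self_mem_nhdsWithin).exists
    have h5 : ρ' ∈ R := interior_subset (s := P.carrier) h2
    have h4 : ρ' ≤ ρ := hmax h5
    exact absurd h3 (not_lt.2 h4)
  rw [P.frontier_eq] at hfr
  obtain ⟨i, t, ht, hit⟩ := mem_iUnion.1 hfr
  have hρ0 : 0 < ρ := by linarith
  refine ⟨i, (ρ⁻¹, t), ⟨⟨(inv_pos.2 hρ0).le, ht.1⟩, ⟨inv_le_one_of_one_le₀ hρ1, ht.2⟩⟩, ?_⟩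
  simp only [polar, hit, add_sub_cancel_left]
  rw [inv_smul_smul₀ hρ0.ne', add_sub_cancel]

/-- The determinant is the radius times the quantity in `counterclockwise` at `z = c`. It vanishes
at radius zero, which integrals tolerate. -/
theorem det_fderiv_polar_nonneg {c : ℝ × ℝ} (hc : c ∈ P.carrier) (i : Fin (n + 1)) {x : ℝ × ℝ}
    (hx : x ∈ Icc (0 : ℝ × ℝ) 1) : 0 ≤ (fderiv ℝ (P.polar c i) x).det := by
  have he : HasFDerivAt (fun x : ℝ × ℝ => P.edge i x.2)
      ((ContinuousLinearMap.snd ℝ ℝ ℝ).smulRight (deriv (P.edge i) x.2)) x := by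
    have h1 := (((P.smooth_edge i).differentiable (by simp) x.2).hasDerivAt.hasFDerivAt).comp x
      (hasFDerivAt_snd (𝕜 := ℝ) (E := ℝ) (F := ℝ) (p := x))
    refine h1.congr_fderiv ?_
    ext <;> simp
  have h2 : HasFDerivAt (P.polar c i) (x.1 • (ContinuousLinearMap.snd ℝ ℝ ℝ).smulRight
      (deriv (P.edge i) x.2) + (ContinuousLinearMap.fst ℝ ℝ ℝ).smulRight (P.edge i x.2 - c)) x :=
    (hasFDerivAt_fst.smul (he.sub_const c)).const_add c
  rw [h2.fderiv, det_eq_cross]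
  have h3 := P.counterclockwise i x.2 ⟨hx.1.2, hx.2.2⟩ c hc
  have h4 := mul_nonneg hx.1.1 h3
  simp only [cross, Prod.fst_sub, Prod.snd_sub] at h4
  simp [cross]
  linarith

variable {P} {L : LegendrianLink}

theorem contDiff_comp_polar (f : P.Immersion L) (c : ℝ × ℝ) (i : Fin (n + 1)) :
    ContDiff ℝ ∞ (f.1 ∘ P.polar c i) := f.2.1.comp (P.contDiff_polar c i)

theorem det_fderiv_comp_polar_nonneg (f : P.Immersion L) {c : ℝ × ℝ} (hc : c ∈ P.carrier)
    (i : Fin (n + 1)) {x : ℝ × ℝ} (hx : x ∈ Icc (0 : ℝ × ℝ) 1) :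
    0 ≤ (fderiv ℝ (f.1 ∘ P.polar c i) x).det := by
  rw [fderiv_comp x (f.2.1.differentiable (by simp) _)
    ((P.contDiff_polar c i).differentiable (by simp) _)]
  have := mul_nonneg (f.2.2.1 _ (P.polar_mem hc i hx)).le (P.det_fderiv_polar_nonneg hc i hx)
  simpa [ContinuousLinearMap.det, ContinuousLinearMap.toLinearMap_comp, LinearMap.det_comp]
    using this

/-- The integral of `p dq` along the image of the boundary of the polygon. -/
def boundaryIntegral (f : P.Immersion L) : ℝ :=
  ∑ i, ∫ t in (0 : ℝ)..1, (f.1 (P.edge i t)).1 * (deriv (fun t => f.1 (P.edge i t)) t).2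

/-- In Stokes' formula on the square the side at radius zero is constant, the radial sides cancel
cyclically between neighbouring edges, and the sides at radius one remain. -/
theorem sum_setIntegral_det (f : P.Immersion L) (c : ℝ × ℝ) :
    ∑ i, ∫ x in Icc (0 : ℝ × ℝ) 1, (fderiv ℝ (f.1 ∘ P.polar c i) x).det = boundaryIntegral f := by
  have hd : ∀ i x, HasFDerivAt (f.1 ∘ P.polar c i) (fderiv ℝ (f.1 ∘ P.polar c i) x) x := fun i x =>
    ((contDiff_comp_polar f c i).differentiable (by simp) x).hasFDerivAt
  have hvert : ∀ i (r t : ℝ), fderiv ℝ (f.1 ∘ P.polar c i) (r, t) (0, 1) =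
      deriv (fun t => f.1 (P.polar c i (r, t))) t := fun i r t => by
    have h1 : HasDerivAt (fun t : ℝ => ((r, t) : ℝ × ℝ)) (0, 1) t :=
      (hasDerivAt_const t r).prodMk (hasDerivAt_id t)
    exact ((hd i (r, t)).comp_hasDerivAt t h1).deriv.symm
  have hhor : ∀ i (r t : ℝ), fderiv ℝ (f.1 ∘ P.polar c i) (r, t) (1, 0) =
      deriv (fun r => f.1 (P.polar c i (r, t))) r := fun i r t => by
    have h1 : HasDerivAt (fun r : ℝ => ((r, t) : ℝ × ℝ)) (1, 0) r :=
      (hasDerivAt_id r).prodMk (hasDerivAt_const r t)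
    exact ((hd i (r, t)).comp_hasDerivAt r h1).deriv.symm
  set side : Fin (n + 1) → ℝ := fun i =>
    ∫ r in (0 : ℝ)..1, pullbackPdq (f.1 ∘ P.polar c i) (1, 0) (r, 0) with hside
  have hnext : ∀ i, ∫ r in (0 : ℝ)..1, pullbackPdq (f.1 ∘ P.polar c i) (1, 0) (r, 1) =
      side (i + 1) := by
    intro i
    have h : ∀ r : ℝ, P.polar c i (r, 1) = P.polar c (i + 1) (r, 0) := fun r => by
      simp [polar, P.edge_one]
    simp only [hside, pullbackPdq, hhor, Function.comp_apply, h]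
  have hone : ∀ i t, P.polar c i (1, t) = P.edge i t := fun i t => by simp [polar]
  have hzero : ∀ i t, P.polar c i (0, t) = c := fun i t => by simp [polar]
  have hi : ∀ i, ∫ x in Icc (0 : ℝ × ℝ) 1, (fderiv ℝ (f.1 ∘ P.polar c i) x).det =
      (∫ t in (0 : ℝ)..1, (f.1 (P.edge i t)).1 * (deriv (fun t => f.1 (P.edge i t)) t).2) -
        side (i + 1) + side i := by
    intro i
    rw [setIntegral_det_fderiv (contDiff_comp_polar f c i), hnext]
    simp [pullbackPdq, hvert, hone, hzero, hside]
  simp only [hi, Finset.sum_add_distrib, Finset.sum_sub_distrib, boundaryIntegral]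
  have hshift : ∑ i, side (i + 1) = ∑ i, side i :=
    Fintype.sum_equiv (Equiv.addRight (1 : Fin (n + 1))) _ _ fun i => rfl
  rw [hshift]
  ring

theorem boundaryIntegral_nonneg (f : P.Immersion L) : 0 ≤ boundaryIntegral f := by
  obtain ⟨c, hc⟩ := P.nonempty_interior
  rw [← sum_setIntegral_det f c]
  exact Finset.sum_nonneg fun i _ => setIntegral_nonneg measurableSet_Icc fun x hx =>
    det_fderiv_comp_polar_nonneg f (interior_subset hc) i hx

/-- At a common point both parameters equal its image under `f`, so the sections agree there and
thus, by uniqueness of lifts, on all of `T`. -/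
theorem disjoint_image_of_sections (f : P.Immersion L) {T : Set (ℝ × ℝ)} (hT : IsPreconnected T)
    {s s' : ℝ × ℝ → ℝ × ℝ} (hs : s ∈ sections f.1 P.carrier T)
    (hs' : s' ∈ sections f.1 P.carrier T) (hne : s ≠ s') : Disjoint (s '' T) (s' '' T) := by
  rw [disjoint_left]
  rintro _ ⟨t, ht, rfl⟩ ⟨t', ht', h⟩
  have htt : t' = t := by rw [← hs'.1.right_inv t' ht', h, hs.1.right_inv t ht]
  subst htt
  refine hne (funext fun y => ?_)
  by_cases hy : y ∈ T
  · exact eqOn_of_lifts f.2.1 f.2.2.1 hT hs.1.cont hs'.1.cont hs.1.mapsTo hs'.1.mapsTo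
      (fun t ht => by rw [hs.1.right_inv t ht, hs'.1.right_inv t ht]) ht h.symm hy
  · rw [hs.2 y hy, hs'.2 y hy]

/-- The area covered by the sections over a set is at most the integral of `p dq` over the boundary
(Stokes' theorem). -/
theorem card_mul_volume_le (f : P.Immersion L) {T : Set (ℝ × ℝ)} (hT : IsPreconnected T)
    (hTc : IsCompact T) (F : Finset (ℝ × ℝ → ℝ × ℝ)) (hF : ∀ s ∈ F, s ∈ sections f.1 P.carrier T) :
    (F.card : ENNReal) * volume T ≤ ENNReal.ofReal (boundaryIntegral f) := by
  obtain ⟨c, hc⟩ := P.nonempty_interior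
  have hcC := interior_subset hc
  let Q : Set (ℝ × ℝ) := Icc 0 1
  -- The part of the section in polar coordinates. For fixed `s` the images of these sets cover `T`;
  -- for fixed `i` they are disjoint, so the integrals over them add up.
  let A : (ℝ × ℝ → ℝ × ℝ) → Fin (n + 1) → Set (ℝ × ℝ) := fun s i => Q ∩ P.polar c i ⁻¹' (s '' T)
  have hA : ∀ s ∈ F, ∀ i, MeasurableSet (A s i) := fun s hs i =>
    (isClosed_Icc.inter ((hTc.image_of_continuousOn (hF s hs).1.cont).isClosed.preimage
      (P.contDiff_polar c i).continuous)).measurableSet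
  have hvol : ∀ s ∈ F, volume T ≤ ∑ i, ∫⁻ x in A s i,
      ENNReal.ofReal |(fderiv ℝ (f.1 ∘ P.polar c i) x).det| := by
    intro s hs
    have hsub : T ⊆ ⋃ i, (f.1 ∘ P.polar c i) '' A s i := by
      intro t ht
      obtain ⟨i, x, hx, hxt⟩ := P.exists_polar_eq c ((hF s hs).1.mapsTo ht)
      refine mem_iUnion.2 ⟨i, x, ⟨hx, t, ht, hxt.symm⟩, ?_⟩
      rw [Function.comp_apply, hxt, (hF s hs).1.right_inv t ht]
    refine (measure_mono hsub).trans ((measure_iUnion_fintype_le _ _).trans ?_)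
    refine Finset.sum_le_sum fun i _ => ?_
    exact addHaar_image_le_lintegral_abs_det_fderiv volume (hA s hs i) fun x _ =>
      ((contDiff_comp_polar f c i).differentiable (by simp) x).hasFDerivAt.hasFDerivWithinAt
  calc (F.card : ENNReal) * volume T = ∑ s ∈ F, volume T := by simp
    _ ≤ ∑ s ∈ F, ∑ i, ∫⁻ x in A s i, ENNReal.ofReal |(fderiv ℝ (f.1 ∘ P.polar c i) x).det| :=
      Finset.sum_le_sum hvol
    _ = ∑ i, ∑ s ∈ F, ∫⁻ x in A s i, ENNReal.ofReal |(fderiv ℝ (f.1 ∘ P.polar c i) x).det| :=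
      Finset.sum_comm
    _ = ∑ i, ∫⁻ x in ⋃ s ∈ F, A s i, ENNReal.ofReal |(fderiv ℝ (f.1 ∘ P.polar c i) x).det| := by
      refine Finset.sum_congr rfl fun i _ => (lintegral_biUnion_finset ?_ (fun s hs => hA s hs i)
        _).symm
      intro s hs s' hs' hne
      have := disjoint_image_of_sections f hT (hF s hs) (hF s' hs') hne
      exact (this.preimage (P.polar c i)).mono inter_subset_right inter_subset_right
    _ ≤ ∑ i, ∫⁻ x in Q, ENNReal.ofReal |(fderiv ℝ (f.1 ∘ P.polar c i) x).det| :=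
      Finset.sum_le_sum fun i _ => lintegral_mono_set (iUnion₂_subset fun s _ => inter_subset_left)
    _ = ∑ i, ENNReal.ofReal (∫ x in Q, (fderiv ℝ (f.1 ∘ P.polar c i) x).det) := by
      refine Finset.sum_congr rfl fun i _ => ?_
      have hcont : Continuous fun x => (fderiv ℝ (f.1 ∘ P.polar c i) x).det :=
        ContinuousLinearMap.continuous_det.comp
          ((contDiff_comp_polar f c i).continuous_fderiv (by simp))
      rw [ofReal_integral_eq_lintegral_ofReal
        (hcont.continuousOn.integrableOn_compact isCompact_Icc)
        ((ae_restrict_mem measurableSet_Icc).mono fun x hx =>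
          det_fderiv_comp_polar_nonneg f hcC i hx)]
      exact setLIntegral_congr_fun measurableSet_Icc fun x hx => by
        simp only [abs_of_nonneg (det_fderiv_comp_polar_nonneg f hcC i hx)]
    _ = ENNReal.ofReal (boundaryIntegral f) := by
      rw [← sum_setIntegral_det f c, ENNReal.ofReal_sum_of_nonneg fun i _ =>
        setIntegral_nonneg measurableSet_Icc fun x hx => det_fderiv_comp_polar_nonneg f hcC i hx]

end CurvedConvexPolygon

/-! ### Heights along the diagram and at corners -/

theorem cross_eq_zero_of_parallel {a b v : ℝ × ℝ} (hv : v ≠ 0) (ha : cross a v = 0)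
    (hb : cross b v = 0) : cross a b = 0 := by
  simp only [cross] at *
  by_contra h
  apply hv
  have h1 : (a.1 * b.2 - a.2 * b.1) * v.1 = 0 := by linear_combination a.1 * hb * (-1) + b.1 * ha
  have h2 : (a.1 * b.2 - a.2 * b.1) * v.2 = 0 := by linear_combination (-a.2) * hb + b.2 * ha
  exact Prod.ext ((mul_eq_zero.1 h1).resolve_left h) ((mul_eq_zero.1 h2).resolve_left h)

namespace LegendrianLink

variable {L : LegendrianLink}

/-- `h` is the `u`-coordinate of a point of the link over `a` at which the diagram is tangent to
`v`. -/
def IsTangentHeight (L : LegendrianLink) (a v : ℝ × ℝ) (h : ℝ) : Prop :=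
  ∃ i s, L.proj i s = a ∧ L.u i s = h ∧ cross (L.vel i s) v = 0

/-- Branches at a double point are transverse, so a nonzero tangent direction singles out one of
them. -/
theorem IsTangentHeight.unique (hL : L.IsGeneric) {a v : ℝ × ℝ} (hv : v ≠ 0) {h h' : ℝ}
    (H : L.IsTangentHeight a v h) (H' : L.IsTangentHeight a v h') : h = h' := by
  obtain ⟨i, s, h1, rfl, h2⟩ := H
  obtain ⟨j, t, h3, rfl, h4⟩ := H'
  by_contra hne
  exact hL.transverse i s j t (h1.trans h3.symm) hne (cross_eq_zero_of_parallel hv h2 h4)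

theorem exists_height_of_param {c : ℝ → ℝ × ℝ} (hc : ContDiff ℝ ∞ c) {t₀ : ℝ}
    (ht₀ : t₀ ∈ Icc (0 : ℝ) 1) {i : Fin L.numComponents} {s₀ : ℝ} {α : ℝ → ℝ}
    (hα : ∀ᶠ t in 𝓝 t₀, DifferentiableAt ℝ α t)
    (h : ∀ᶠ t in 𝓝[Icc 0 1] t₀, c t = L.proj i (s₀ + α t)) :
    ∃ η : ℝ → ℝ, (∀ᶠ t in 𝓝[Icc 0 1] t₀, L.IsTangentHeight (c t) (deriv c t) (η t)) ∧
      HasDerivWithinAt η ((c t₀).1 * (deriv c t₀).2) (Icc 0 1) t₀ := by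
  have hder : ∀ t ∈ Icc (0 : ℝ) 1, DifferentiableAt ℝ α t →
      (∀ᶠ t' in 𝓝[Icc 0 1] t, c t' = L.proj i (s₀ + α t')) →
      deriv c t = deriv α t • L.vel i (s₀ + α t) := by
    intro t ht hαt hct
    have h1 : HasDerivAt (fun t => L.proj i (s₀ + α t)) (deriv α t • L.vel i (s₀ + α t)) t :=
      HasDerivAt.scomp (g₁ := L.proj i) (h := fun t => s₀ + α t) t
        (L.hasDerivAt_proj i (s₀ + α t)) (hαt.hasDerivAt.const_add s₀)
    have h2 : HasDerivWithinAt c (deriv α t • L.vel i (s₀ + α t)) (Icc 0 1) t :=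
      h1.hasDerivWithinAt.congr_of_eventuallyEq hct (hct.self_of_nhdsWithin ht)
    exact (uniqueDiffOn_Icc_zero_one t ht).eq_deriv _
      (hc.differentiable (by simp) t).hasDerivAt.hasDerivWithinAt h2
  refine ⟨fun t => L.u i (s₀ + α t), ?_, ?_⟩
  · filter_upwards [h, eventually_eventually_nhdsWithin.2 h, nhdsWithin_le_nhds hα,
      self_mem_nhdsWithin] with t h1 h2 h3 h4
    refine ⟨i, s₀ + α t, h1.symm, rfl, ?_⟩
    rw [hder t h4 h3 h2, cross_smul_right, cross_self, mul_zero]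
  · have h3 := hα.self_of_nhds
    have h1 := (L.hasDerivAt_u i (s₀ + α t₀)).comp t₀ (h3.hasDerivAt.const_add s₀)
    rw [hder t₀ ht₀ h3 h, h.self_of_nhdsWithin ht₀]
    refine h1.hasDerivWithinAt.congr_deriv ?_
    simp only [Prod.smul_snd, smul_eq_mul]
    ring

/-- A regular curve in the diagram cannot change branches at a crossing: in straightened coordinates
one component has nonzero derivative at `t₀`, so it is nonzero at nearby `t ≠ t₀` and the curve
follows one axis. -/
theorem exists_height_nhds (hL : L.IsGeneric) {c : ℝ → ℝ × ℝ} (hc : ContDiff ℝ ∞ c)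
    (hcY : ∀ t ∈ Icc (0 : ℝ) 1, c t ∈ L.diagram) {t₀ : ℝ} (ht₀ : t₀ ∈ Icc (0 : ℝ) 1)
    (hreg : deriv c t₀ ≠ 0) :
    ∃ η : ℝ → ℝ, (∀ᶠ t in 𝓝[Icc 0 1] t₀, L.IsTangentHeight (c t) (deriv c t) (η t)) ∧
      HasDerivWithinAt η ((c t₀).1 * (deriv c t₀).2) (Icc 0 1) t₀ := by
  obtain ⟨M⟩ := exists_localModel hL (c t₀)
  obtain ⟨e, he, h0, hsm, δ, hδ, hball, hcoord⟩ := M.exists_coords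
  set d : ℝ → ℝ × ℝ := fun t => e.symm (c t) with hd
  have hdsm : ContDiffAt ℝ ∞ d t₀ := hsm.comp t₀ hc.contDiffAt
  have he0 : e 0 = c t₀ := by rw [he, M.map_zero]
  have hd0 : d t₀ = 0 := by rw [hd]; simp only; rw [← he0, e.left_inv h0]
  have hdiff : ∀ᶠ t in 𝓝 t₀, DifferentiableAt ℝ d t := by
    have h1 : ContDiffAt ℝ 1 d t₀ := hdsm.of_le (by simp)
    filter_upwards [h1.eventually (by simp)] with t ht
    exact ht.differentiableAt (by simp)
  have hmap : ∀ᶠ t in 𝓝 t₀, M.map (d t) = c t := by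
    have : c t₀ ∈ e.target := by rw [← he0]; exact e.map_source h0
    filter_upwards [hc.continuous.continuousAt.eventually (e.open_target.mem_nhds this)] with t ht
    rw [← he, hd]
    exact e.right_inv ht
  have hsmall : ∀ᶠ t in 𝓝 t₀, d t ∈ Metric.closedBall 0 δ := by
    have := hdsm.continuousAt.eventually (Metric.closedBall_mem_nhds (d t₀) hδ)
    rwa [hd0] at this
  have hdd := hdiff.self_of_nhds.hasDerivAt
  have hd1 : HasDerivAt (fun t => (d t).1) (deriv d t₀).1 t₀ := hdd.fst
  have hd2 : HasDerivAt (fun t => (d t).2) (deriv d t₀).2 t₀ := hdd.snd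
  have hne : (deriv d t₀).1 ≠ 0 ∨ (deriv d t₀).2 ≠ 0 := by
    by_contra h
    push Not at h
    apply hreg
    have h1 : HasDerivAt (fun t => M.map (d t)) (fderiv ℝ M.map (d t₀) (deriv d t₀)) t₀ :=
      (M.contDiff_map.differentiable (by simp) (d t₀)).hasFDerivAt.comp_hasDerivAt t₀ hdd
    have h2 : deriv d t₀ = 0 := Prod.ext h.1 h.2
    rw [h2, map_zero] at h1
    exact (h1.congr_of_eventuallyEq (hmap.mono fun t ht => ht.symm)).deriv
  -- Some nearby parameter other than `t₀` is needed to see that `b₁` or `b₂` holds.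
  have hacc : (𝓝[Icc 0 1 \ {t₀}] t₀).NeBot := by
    have h1 := uniqueDiffOn_Icc_zero_one t₀ ht₀
    rw [uniqueDiffWithinAt_iff_accPt, accPt_principal_iff_nhdsWithin] at h1
    exact h1
  have hloc : ∀ᶠ t in 𝓝[Icc 0 1] t₀, (M.b₁ ∧ (d t).2 = 0) ∨ (M.b₂ ∧ (d t).1 = 0) := by
    filter_upwards [nhdsWithin_le_nhds hmap, nhdsWithin_le_nhds hsmall, self_mem_nhdsWithin] with
      t h1 h2 h3
    obtain ⟨i, s, his⟩ := hcY t h3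
    exact (hcoord _ h2 i s (his.trans h1.symm)).imp (fun h => ⟨h.1, h.2.1⟩) fun h => ⟨h.1, h.2.1⟩
  have hle : 𝓝[Icc 0 1 \ {t₀}] t₀ ≤ 𝓝[Icc 0 1] t₀ := nhdsWithin_mono _ sdiff_subset
  have hle' : 𝓝[Icc 0 1 \ {t₀}] t₀ ≤ 𝓝[≠] t₀ := nhdsWithin_mono _ fun t ht => ht.2
  have hfill : ∀ p : ℝ → Prop, p t₀ → (∀ᶠ t in 𝓝[Icc 0 1 \ {t₀}] t₀, p t) →
      ∀ᶠ t in 𝓝[Icc 0 1] t₀, p t := by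
    intro p h1 h2
    rw [eventually_nhdsWithin_iff] at h2 ⊢
    filter_upwards [h2] with t h3 h4
    by_cases h5 : t = t₀
    · rwa [h5]
    · exact h3 ⟨h4, h5⟩
  rcases hne with hne | hne
  · have hev : ∀ᶠ t in 𝓝[Icc 0 1 \ {t₀}] t₀, M.b₁ ∧ (d t).2 = 0 := by
      filter_upwards [hle' (hd1.eventually_ne (c := 0) hne), hle hloc] with t h1 h2
      exact h2.resolve_right fun h => h1 h.2
    obtain ⟨i, s₀, hi⟩ := M.branch₁ hev.exists.choose_spec.1
    refine exists_height_of_param hc ht₀ (i := i) (s₀ := s₀) (α := fun t => (d t).1)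
      (hdiff.mono fun t ht => ht.fst) ?_
    filter_upwards [nhdsWithin_le_nhds hmap, hfill (fun t => (d t).2 = 0) (by simp [hd0])
      (hev.mono fun t ht => ht.2)] with t h1 h2
    rw [← (hi _).1, ← h1, ← M.map_fst]
    congr 1
    exact Prod.ext rfl h2
  · have hev : ∀ᶠ t in 𝓝[Icc 0 1 \ {t₀}] t₀, M.b₂ ∧ (d t).1 = 0 := by
      filter_upwards [hle' (hd2.eventually_ne (c := 0) hne), hle hloc] with t h1 h2
      exact h2.resolve_left fun h => h1 h.2
    obtain ⟨i, s₀, hi⟩ := M.branch₂ hev.exists.choose_spec.1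
    refine exists_height_of_param hc ht₀ (i := i) (s₀ := s₀) (α := fun t => (d t).2)
      (hdiff.mono fun t ht => ht.snd) ?_
    filter_upwards [nhdsWithin_le_nhds hmap, hfill (fun t => (d t).1 = 0) (by simp [hd0])
      (hev.mono fun t ht => ht.2)] with t h1 h2
    rw [← (hi _).1, ← h1, ← M.map_snd]
    congr 1
    exact Prod.ext h2 rfl

/-- The integral of `p dq` along a regular curve in the diagram is the difference of the
`u`-coordinates of the lifts of its endpoints to the link. -/
theorem exists_heights (hL : L.IsGeneric) {c : ℝ → ℝ × ℝ} (hc : ContDiff ℝ ∞ c)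
    (hcY : ∀ t ∈ Icc (0 : ℝ) 1, c t ∈ L.diagram) (hreg : ∀ t ∈ Icc (0 : ℝ) 1, deriv c t ≠ 0) :
    ∃ h₀ h₁, L.IsTangentHeight (c 0) (deriv c 0) h₀ ∧ L.IsTangentHeight (c 1) (deriv c 1) h₁ ∧
      ∫ t in (0 : ℝ)..1, (c t).1 * (deriv c t).2 = h₁ - h₀ := by
  have hloc := fun t (ht : t ∈ Icc (0 : ℝ) 1) => exists_height_nhds hL hc hcY ht (hreg t ht)
  have hex : ∀ t, ∃ h, t ∈ Icc (0 : ℝ) 1 → L.IsTangentHeight (c t) (deriv c t) h := by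
    intro t
    by_cases ht : t ∈ Icc (0 : ℝ) 1
    · obtain ⟨η, h1, -⟩ := hloc t ht
      exact ⟨η t, fun _ => h1.self_of_nhdsWithin ht⟩
    · exact ⟨0, fun h => (ht h).elim⟩
  choose U hU using hex
  have hder : ∀ t ∈ Icc (0 : ℝ) 1, HasDerivWithinAt U ((c t).1 * (deriv c t).2) (Icc 0 1) t := by
    intro t ht
    obtain ⟨η, h1, h2⟩ := hloc t ht
    -- `U` was chosen point by point, but uniqueness of tangent heights makes it agree with the
    -- differentiable `η`.
    have h3 : ∀ᶠ t' in 𝓝[Icc 0 1] t, U t' = η t' := by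
      filter_upwards [h1, self_mem_nhdsWithin] with t' h4 h5
      exact (hU t' h5).unique hL (hreg t' h5) h4
    exact h2.congr_of_eventuallyEq h3 (h3.self_of_nhdsWithin ht)
  refine ⟨U 0, U 1, hU 0 ⟨le_rfl, zero_le_one⟩, hU 1 ⟨zero_le_one, le_rfl⟩, ?_⟩
  have hcont : Continuous fun t => (c t).1 * (deriv c t).2 :=
    (continuous_fst.comp hc.continuous).mul
      (continuous_snd.comp (hc.continuous_deriv (by simp)))
  refine intervalIntegral.integral_eq_sub_of_hasDerivAt_of_le zero_le_one
    (fun t ht => (hder t ht).continuousWithinAt) (fun t ht => ?_) (hcont.intervalIntegrable _ _)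
  exact (hder t (Ioo_subset_Icc_self ht)).hasDerivAt (Icc_mem_nhds ht.1 ht.2)

section Corner

variable {a vi vo w : ℝ × ℝ} {hi ho x y : ℝ}

/-- At a corner with incoming tangent vector `vi` and outgoing tangent vector `vo` a vector between
`vo` and `-vi` points into the sector from the branch tangent to `vo` to the branch tangent to
`vi`. -/
theorem corner_heights (hL : L.IsGeneric) (hin : L.IsTangentHeight a vi hi)
    (hout : L.IsTangentHeight a vo ho) (hpos : 0 < cross vi vo) (hx : 0 < x) (hy : 0 < y)
    (hw : w = x • vo - y • vi) {i j : Fin L.numComponents} {s t : ℝ} (his : L.proj i s = a)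
    (hjt : L.proj j t = a) (hlt : L.u i s < L.u j t) {α β : ℝ}
    (hαβ : w = α • L.vel i s + β • L.vel j t) :
    (ho = L.u i s ∧ hi = L.u j t ∧ 0 < cross (α • L.vel i s) (β • L.vel j t)) ∨
      (hi = L.u i s ∧ ho = L.u j t ∧ cross (α • L.vel i s) (β • L.vel j t) < 0) := by
  obtain ⟨k, r, hk, rfl, hkv⟩ := hin
  obtain ⟨l, r', hl, rfl, hlv⟩ := hout
  have hvi : vi ≠ 0 := by rintro rfl; simp [cross] at hpos
  have hvo : vo ≠ 0 := by rintro rfl; simp [cross] at hpos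
  have hvel : ∀ {m n : Fin L.numComponents} {b b' : ℝ}, L.proj m b = a → L.proj n b' = a →
      L.u m b = L.u n b' → L.vel m b = L.vel n b' := fun h1 h2 h3 =>
    L.vel_eq_of_proj_eq_of_u_eq (h1.trans h2.symm) h3
  have hne : L.u k r ≠ L.u l r' := fun h => by
    have h1 := hvel hk hl h
    rw [← h1, cross_comm, neg_eq_zero] at hlv
    rw [cross_comm, neg_eq_zero] at hkv
    have := cross_eq_zero_of_parallel (L.vel_ne_zero k r) hkv hlv
    exact hpos.ne' this
  have htwo : ∀ {m : Fin L.numComponents} {b : ℝ}, L.proj m b = a →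
      L.u k r = L.u m b ∨ L.u l r' = L.u m b := fun {m b} h => by
    rcases hL.no_triple k r l r' m b (hk.trans hl.symm) (hl.trans h.symm) with h' | h' | h'
    · exact (hne h').elim
    · exact Or.inr h'
    · exact Or.inl h'
  -- With `V` parallel to `vo` and `W` to `vi`, comparing coefficients of `w` gives `α * β * cross V
  -- W = x * y * cross vi vo`.
  have key : ∀ V W : ℝ × ℝ, cross V vo = 0 → cross W vi = 0 → cross V W ≠ 0 →
      ∀ α β : ℝ, w = α • V + β • W → 0 < α * β * cross V W := by
    intro V W hV hW hVW α β hwV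
    have e1 : β * cross V W = -(y * cross V vi) := by
      have : cross V w = cross V w := rfl
      conv_lhs at this => rw [hwV]
      rw [hw] at this
      simp only [cross, Prod.fst_add, Prod.snd_add, Prod.fst_sub, Prod.snd_sub, Prod.smul_fst,
        Prod.smul_snd, smul_eq_mul] at this hV ⊢
      linear_combination this + x * hV
    have e2 : α * cross V W = -(x * cross W vo) := by
      have : cross w W = cross w W := rfl
      conv_lhs at this => rw [hwV]
      rw [hw] at this
      simp only [cross, Prod.fst_add, Prod.snd_add, Prod.fst_sub, Prod.snd_sub, Prod.smul_fst,
        Prod.smul_snd, smul_eq_mul] at this hW ⊢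
      linear_combination this + y * hW
    have e3 : cross V vi * cross W vo = cross V W * cross vi vo := by
      simp only [cross] at hV hW ⊢
      linear_combination (-W.2 * vi.1 + W.1 * vi.2) * hV
    have h4 : (α * β * cross V W) * cross V W = x * y * (cross V W * cross vi vo) := by
      rw [← e3]
      linear_combination (β * cross V W) * e2 - x * cross W vo * e1
    have h5 : α * β * cross V W = x * y * cross vi vo := by
      apply mul_right_cancel₀ hVW
      rw [h4]
      ring
    rw [h5]
    positivity
  have hcr : ∀ V W : ℝ × ℝ, cross (α • V) (β • W) = α * β * cross V W := fun V W => by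
    rw [cross_smul_left, cross_smul_right]
    ring
  have htrans := hL.transverse i s j t (his.trans hjt.symm) hlt.ne
  rcases htwo his with h1 | h1 <;> rcases htwo hjt with h2 | h2
  · exact (hlt.ne (h1.symm.trans h2)).elim
  · right
    refine ⟨h1, h2, ?_⟩
    rw [hvel hk his h1] at hkv
    rw [hvel hl hjt h2] at hlv
    have := key (L.vel j t) (L.vel i s) hlv hkv (by rw [cross_comm]; exact neg_ne_zero.2 htrans)
      β α (by rw [hαβ, add_comm])
    rw [cross_comm (L.vel j t)] at this
    rw [hcr]
    linarith
  · left
    refine ⟨h1, h2, ?_⟩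
    rw [hvel hk hjt h2] at hkv
    rw [hvel hl his h1] at hlv
    rw [hcr]
    exact key (L.vel i s) (L.vel j t) hlv hkv htrans α β hαβ
  · exact (hlt.ne (h1.symm.trans h2)).elim

theorem lt_of_mem_positiveSectors (hL : L.IsGeneric) (hin : L.IsTangentHeight a vi hi)
    (hout : L.IsTangentHeight a vo ho) (hpos : 0 < cross vi vo) (hx : 0 < x) (hy : 0 < y)
    (hw : x • vo - y • vi ∈ L.positiveSectors a) : ho < hi := by
  obtain ⟨i, s, j, t, h1, h2, h3, α, β, h4, h5⟩ := hw
  rcases corner_heights hL hin hout hpos hx hy rfl h1 h2 h3 h4 with ⟨h6, h7, -⟩ | ⟨-, -, h8⟩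
  · rwa [h6, h7]
  · exact (h5.not_gt h8).elim

theorem lt_of_mem_negativeSectors (hL : L.IsGeneric) (hin : L.IsTangentHeight a vi hi)
    (hout : L.IsTangentHeight a vo ho) (hpos : 0 < cross vi vo) (hx : 0 < x) (hy : 0 < y)
    (hw : x • vo - y • vi ∈ L.negativeSectors a) : hi < ho := by
  obtain ⟨i, s, j, t, h1, h2, h3, α, β, h4, h5⟩ := hw
  rcases corner_heights hL hin hout hpos hx hy rfl h1 h2 h3 h4 with ⟨-, -, h8⟩ | ⟨h6, h7, -⟩
  · exact (h5.not_gt h8).elim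
  · rwa [h6, h7]

end Corner

/-- Only two heights occur over a double point, by `no_triple`. -/
theorem exists_gap (hL : L.IsGeneric) (a : L.DoublePoint) : ∃ g > 0, ∀ i s j t,
    L.proj i s = a.1 → L.proj j t = a.1 → L.u i s < L.u j t → L.u j t - L.u i s = g := by
  obtain ⟨k, r, l, r', hk, hl, hne⟩ := a.2
  have key : ∀ {m : Fin L.numComponents} {b : ℝ}, L.proj m b = a.1 →
      L.u m b = L.u k r ∨ L.u m b = L.u l r' := fun {m b} h => by
    rcases hL.no_triple k r l r' m b (hk.trans hl.symm) (hl.trans h.symm) with h' | h' | h'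
    · exact (hne h').elim
    · exact Or.inr h'.symm
    · exact Or.inl h'.symm
  refine ⟨|L.u k r - L.u l r'|, abs_pos.2 (sub_ne_zero.2 hne), fun i s j t h1 h2 h3 => ?_⟩
  rcases key h1 with h4 | h4 <;> rcases key h2 with h5 | h5 <;> rw [h4, h5] at h3 ⊢
  · exact (lt_irrefl _ h3).elim
  · rw [abs_of_neg (by linarith), neg_sub]
  · rw [abs_of_pos (by linarith)]
  · exact (lt_irrefl _ h3).elim

/-- The difference of the `u`-coordinates of the two branches at a double point. -/
def gap (hL : L.IsGeneric) (a : L.DoublePoint) : ℝ := (exists_gap hL a).choose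

theorem gap_pos (hL : L.IsGeneric) (a : L.DoublePoint) : 0 < L.gap hL a :=
  (exists_gap hL a).choose_spec.1

theorem IsTangentHeight.sub_eq_gap (hL : L.IsGeneric) {a : L.DoublePoint} {v w : ℝ × ℝ} {h h' : ℝ}
    (H : L.IsTangentHeight a.1 v h) (H' : L.IsTangentHeight a.1 w h') (hlt : h < h') :
    h' - h = gap hL a := by
  obtain ⟨i, s, h1, rfl, -⟩ := H
  obtain ⟨j, t, h2, rfl, -⟩ := H'
  exact (exists_gap hL a).choose_spec.2 i s j t h1 h2 hlt

end LegendrianLink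

/-! ### The area formula -/

namespace CurvedConvexPolygon

variable {n : ℕ} (P : CurvedConvexPolygon n)

/-- Edge tangents are supporting lines; an interior point still satisfies the weak inequality after
a small shift towards the line, so its own inequality is strict. -/
theorem cross_pos_of_interior (i : Fin (n + 1)) {t : ℝ} (ht : t ∈ Icc (0 : ℝ) 1) {z : ℝ × ℝ}
    (hz : z ∈ interior P.carrier) : 0 < cross (deriv (P.edge i) t) (z - P.edge i t) := by
  set E := deriv (P.edge i) t with hE
  have hE0 : E ≠ 0 := P.regular_edge i t ht
  have hpos : 0 < cross E (-E.2, E.1) :=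
    lt_of_le_of_ne (by rw [cross_rotate]; positivity) (cross_rotate_ne_zero hE0).symm
  have hcont : ContinuousAt (fun ε : ℝ => z - ε • ((-E.2, E.1) : ℝ × ℝ)) 0 := by fun_prop
  have hev : ∀ᶠ ε : ℝ in 𝓝[>] 0, z - ε • ((-E.2, E.1) : ℝ × ℝ) ∈ interior P.carrier := by
    refine nhdsWithin_le_nhds (hcont.eventually (isOpen_interior.mem_nhds ?_))
    simpa using hz
  obtain ⟨ε, h1, h2⟩ := (hev.and self_mem_nhdsWithin).exists
  have h3 := P.counterclockwise i t ht _ (interior_subset h1)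
  have h4 : cross E (z - ε • ((-E.2, E.1) : ℝ × ℝ) - P.edge i t) =
      cross E (z - P.edge i t) - ε * cross E (-E.2, E.1) := by
    simp only [cross, Prod.fst_sub, Prod.snd_sub, Prod.smul_fst, Prod.smul_snd, smul_eq_mul]
    ring
  rw [h4] at h3
  have := mul_pos h2 hpos
  linarith

/-- The directions from a vertex to interior points lie strictly between the two edges. -/
theorem exists_sub_vertex_eq (i : Fin (n + 1)) {z : ℝ × ℝ} (hz : z ∈ interior P.carrier) :
    ∃ x > (0 : ℝ), ∃ y > (0 : ℝ), z - P.vertex (i + 1) =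
      x • deriv (P.edge (i + 1)) 0 - y • deriv (P.edge i) 1 := by
  have h1 := P.cross_pos_of_interior i (t := 1) ⟨zero_le_one, le_rfl⟩ hz
  have h2 := P.cross_pos_of_interior (i + 1) (t := 0) ⟨le_rfl, zero_le_one⟩ hz
  rw [P.edge_one] at h1
  have hD := P.corner i
  change 0 < cross _ (z - P.vertex (i + 1)) at h1
  change 0 < cross _ (z - P.vertex (i + 1)) at h2
  set v := z - P.vertex (i + 1)
  set E := deriv (P.edge (i + 1)) 0
  set E' := deriv (P.edge i) 1
  -- Cramer's rule in the basis of the two edge directions.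
  refine ⟨cross E' v / cross E' E, by positivity, cross E v / cross E' E, by positivity, ?_⟩
  have hD' := hD.ne'
  ext
  · simp only [Prod.fst_sub, Prod.smul_fst, smul_eq_mul]
    field_simp
    simp only [cross]
    ring
  · simp only [Prod.snd_sub, Prod.smul_snd, smul_eq_mul]
    field_simp
    simp only [cross]
    ring

variable {P} {L : LegendrianLink}

theorem hasDerivAt_comp_edge (f : P.Immersion L) (i : Fin (n + 1)) (t : ℝ) :
    HasDerivAt (fun t => f.1 (P.edge i t)) (fderiv ℝ f.1 (P.edge i t) (deriv (P.edge i) t)) t :=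
  (f.2.1.differentiable (by simp) _).hasFDerivAt.comp_hasDerivAt t
    ((P.smooth_edge i).differentiable (by simp) t).hasDerivAt

theorem deriv_comp_edge_ne_zero (f : P.Immersion L) (i : Fin (n + 1)) {t : ℝ}
    (ht : t ∈ Icc (0 : ℝ) 1) : deriv (fun t => f.1 (P.edge i t)) t ≠ 0 := by
  rw [(hasDerivAt_comp_edge f i t).deriv]
  intro h
  have h1 := cross_map (fderiv ℝ f.1 (P.edge i t)) (deriv (P.edge i) t)
    (-(deriv (P.edge i) t).2, (deriv (P.edge i) t).1)
  rw [h] at h1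
  have h2 : cross 0 ((fderiv ℝ f.1 (P.edge i t))
    (-(deriv (P.edge i) t).2, (deriv (P.edge i) t).1)) = 0 := by simp [cross]
  rw [h2] at h1
  exact mul_ne_zero (f.2.2.1 _ (P.edge_mem i ht)).ne'
    (cross_rotate_ne_zero (P.regular_edge i t ht)) h1.symm

/-- The area formula: the integral of `p dq` along the boundary of an admissible immersion is the
gap at the positive vertex minus the gaps at the negative vertices. -/
theorem boundaryIntegral_eq (hL : L.IsGeneric) {f : P.Immersion L} (hf : P.IsAdmissible f)
    {a : Fin (n + 1) → L.DoublePoint} (ha : ∀ i, f.1 (P.vertex i) = (a i).1) :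
    boundaryIntegral f =
      LegendrianLink.gap hL (a 0) - ∑ i : Fin n, LegendrianLink.gap hL (a i.succ) := by
  have hedge : ∀ i, ∃ h₀ h₁, L.IsTangentHeight (f.1 (P.edge i 0))
      (deriv (fun t => f.1 (P.edge i t)) 0) h₀ ∧ L.IsTangentHeight (f.1 (P.edge i 1))
      (deriv (fun t => f.1 (P.edge i t)) 1) h₁ ∧ ∫ t in (0 : ℝ)..1, (f.1 (P.edge i t)).1 *
        (deriv (fun t => f.1 (P.edge i t)) t).2 = h₁ - h₀ := fun i =>
    LegendrianLink.exists_heights hL (f.2.1.comp (P.smooth_edge i))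
      (fun t ht => f.2.2.2 (P.edge_mem_frontier i ht)) fun t ht => deriv_comp_edge_ne_zero f i ht
  choose h₀ h₁ H₀ H₁ hint using hedge
  obtain ⟨z, hz⟩ := P.nonempty_interior
  -- Edge `i` ends where edge `i + 1` starts; the sign of the sector there decides which of the two
  -- heights is larger.
  have hjump : ∀ i, h₁ i - h₀ (i + 1) = if i + 1 = 0 then LegendrianLink.gap hL (a (i + 1))
      else -LegendrianLink.gap hL (a (i + 1)) := by
    intro i
    have hv : f.1 (P.edge i 1) = (a (i + 1)).1 := by rw [P.edge_one]; exact ha (i + 1)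
    have hin := H₁ i
    have hout := H₀ (i + 1)
    rw [hv, (hasDerivAt_comp_edge f i 1).deriv, P.edge_one] at hin
    rw [show f.1 (P.edge (i + 1) 0) = (a (i + 1)).1 from ha (i + 1),
      (hasDerivAt_comp_edge f (i + 1) 0).deriv] at hout
    have hpos : 0 < cross (fderiv ℝ f.1 (P.edge (i + 1) 0) (deriv (P.edge i) 1))
        (fderiv ℝ f.1 (P.edge (i + 1) 0) (deriv (P.edge (i + 1)) 0)) := by
      rw [cross_map]
      exact mul_pos (f.2.2.1 _ (P.vertex_mem _)) (P.corner i)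
    obtain ⟨x, hx, y, hy, hxy⟩ := P.exists_sub_vertex_eq i hz
    have hw : fderiv ℝ f.1 (P.vertex (i + 1)) (z - P.vertex (i + 1)) =
        x • fderiv ℝ f.1 (P.edge (i + 1) 0) (deriv (P.edge (i + 1)) 0) -
          y • fderiv ℝ f.1 (P.edge (i + 1) 0) (deriv (P.edge i) 1) := by
      rw [hxy, map_sub, map_smul, map_smul]
      rfl
    by_cases hi : i + 1 = 0
    · rw [if_pos hi]
      have h := hf.1 z hz
      rw [← hi, hw, ha] at h
      exact hout.sub_eq_gap hL hin
        (LegendrianLink.lt_of_mem_positiveSectors hL hin hout hpos hx hy h)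
    · rw [if_neg hi]
      have h := hf.2 (i + 1) hi z hz
      rw [hw, ha] at h
      have := hin.sub_eq_gap hL hout
        (LegendrianLink.lt_of_mem_negativeSectors hL hin hout hpos hx hy h)
      linarith
  have hshift : ∀ F : Fin (n + 1) → ℝ, ∑ i, F (i + 1) = ∑ i, F i := fun F =>
    Fintype.sum_equiv (Equiv.addRight (1 : Fin (n + 1))) _ _ fun i => rfl
  -- A cyclic shift regroups increments along edges into jumps at corners.
  have h1 : boundaryIntegral f = ∑ i, (h₁ i - h₀ (i + 1)) := by
    rw [boundaryIntegral, Finset.sum_sub_distrib, hshift h₀, ← Finset.sum_sub_distrib]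
    exact Finset.sum_congr rfl fun i _ => hint i
  rw [h1, Finset.sum_congr rfl fun i _ => hjump i,
    hshift fun i => if i = 0 then LegendrianLink.gap hL (a i) else -LegendrianLink.gap hL (a i),
    Fin.sum_univ_succ]
  simp [Fin.succ_ne_zero, sub_eq_add_neg]

end CurvedConvexPolygon

/-! ### Derivations of a free algebra -/

/-- A function on the generators of a free algebra of characteristic two extends uniquely to a
derivation. -/
theorem existsUnique_derivation {X : Type*} (D : X → FreeAlgebra (ZMod 2) X) :
    ∃! d : FreeAlgebra (ZMod 2) X →ₗ[ZMod 2] FreeAlgebra (ZMod 2) X,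
      (∀ x y, d (x * y) = d x * y + x * d y) ∧ ∀ a, d (FreeAlgebra.ι (ZMod 2) a) = D a := by
  let A := FreeAlgebra (ZMod 2) X
  -- A derivation of `A` is the second component of an algebra map to the square-zero extension of
  -- `A` by itself with identity as first component; such a map can be prescribed on generators.
  let φ : A →ₐ[ZMod 2] TrivSqZeroExt A A := FreeAlgebra.lift (ZMod 2) fun a =>
    TrivSqZeroExt.inl (FreeAlgebra.ι (ZMod 2) a) + TrivSqZeroExt.inr (D a)
  have hfst : ∀ x, (φ x).fst = x := by
    intro x
    have h : (TrivSqZeroExt.fstHom (ZMod 2) A A).comp φ = AlgHom.id (ZMod 2) A := by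
      ext a
      simp [φ]
      rfl
    exact congrArg (fun F => F x) h
  have hsnd : ∀ a, (φ (FreeAlgebra.ι (ZMod 2) a)).snd = D a := fun a => by
    have hι : φ (FreeAlgebra.ι (ZMod 2) a) =
        TrivSqZeroExt.inl (FreeAlgebra.ι (ZMod 2) a) + TrivSqZeroExt.inr (D a) :=
      FreeAlgebra.lift_ι_apply _ _
    rw [hι, TrivSqZeroExt.snd_add, TrivSqZeroExt.snd_inl, TrivSqZeroExt.snd_inr, zero_add]
  refine ⟨(TrivSqZeroExt.sndHom A A).restrictScalars (ZMod 2) ∘ₗ φ.toLinearMap, ⟨?_, ?_⟩, ?_⟩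
  · intro x y
    simp [TrivSqZeroExt.snd_mul, hfst, add_comm]
  · exact hsnd
  · rintro d ⟨hd, hd'⟩
    have hone : ∀ e : A →ₗ[ZMod 2] A, (∀ x y, e (x * y) = e x * y + x * e y) → e 1 = 0 := by
      intro e he
      simpa using he 1 1
    have huniq : ∀ e e' : A →ₗ[ZMod 2] A, (∀ x y, e (x * y) = e x * y + x * e y) →
        (∀ x y, e' (x * y) = e' x * y + x * e' y) →
        (∀ a, e (FreeAlgebra.ι (ZMod 2) a) = e' (FreeAlgebra.ι (ZMod 2) a)) → e = e' := by
      intro e e' he he' h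
      ext x
      induction x using FreeAlgebra.induction with
      | grade0 r =>
        rw [Algebra.algebraMap_eq_smul_one, map_smul, map_smul, hone e he, hone e' he']
      | grade1 a => exact h a
      | mul x y hx hy => rw [he, he', hx, hy]
      | add x y hx hy => rw [map_add, map_add, hx, hy]
    refine huniq _ _ hd ?_ fun a => ?_
    · intro x y
      simp [TrivSqZeroExt.snd_mul, hfst, add_comm]
    · rw [hd']
      exact (hsnd a).symm

/-! ### Finiteness of the sum -/

namespace CurvedConvexPolygon

variable {n : ℕ} {P : CurvedConvexPolygon n} {L : LegendrianLink}

theorem sum_gap_le (hL : L.IsGeneric) {f : P.Immersion L} (hf : P.IsAdmissible f)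
    {a : Fin (n + 1) → L.DoublePoint} (ha : ∀ i, f.1 (P.vertex i) = (a i).1) :
    ∑ i : Fin n, LegendrianLink.gap hL (a i.succ) ≤ LegendrianLink.gap hL (a 0) := by
  have h1 := boundaryIntegral_eq hL hf ha
  have h2 := boundaryIntegral_nonneg f
  linarith

theorem boundaryIntegral_le (hL : L.IsGeneric) {f : P.Immersion L} (hf : P.IsAdmissible f)
    {a : Fin (n + 1) → L.DoublePoint} (ha : ∀ i, f.1 (P.vertex i) = (a i).1) :
    boundaryIntegral f ≤ LegendrianLink.gap hL (a 0) := by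
  rw [boundaryIntegral_eq hL hf ha]
  have : 0 ≤ ∑ i : Fin n, LegendrianLink.gap hL (a i.succ) :=
    Finset.sum_nonneg fun i _ => (LegendrianLink.gap_pos hL _).le
  linarith

/-- The gap at `a 0` bounds the area, so over each patch it bounds the number of sections by a
constant independent of the immersion. -/
theorem finite_admissible (hL : L.IsGeneric) (a : Fin (n + 1) → L.DoublePoint) :
    (P.admissible L a).Finite := by
  obtain ⟨S⟩ := LegendrianLink.exists_patchSystem hL
  have := S.finite
  set g := ENNReal.ofReal (LegendrianLink.gap hL (a 0)) with hg
  have hpos : ∀ j, volume (S.T j) ≠ 0 := fun j =>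
    (Measure.measure_pos_of_nonempty_interior volume (S.interior_nonempty j)).ne'
  have hfin : ∀ j, volume (S.T j) ≠ ⊤ := fun j => (S.compact j).measure_lt_top.ne
  have hNj : ∀ j, ∃ N : ℕ, g ≤ N * volume (S.T j) := by
    intro j
    obtain ⟨N, hN⟩ := ENNReal.exists_nat_gt (ENNReal.div_ne_top ENNReal.ofReal_ne_top (hpos j) :
      g / volume (S.T j) ≠ ⊤)
    exact ⟨N, (ENNReal.div_le_iff (hpos j) (hfin j)).1 hN.le⟩
  choose N hN using hNj
  obtain ⟨B, hB⟩ := (Set.finite_range N).bddAbove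
  refine finite_image_mk S (N := B) (a := fun i => (a i).1) (fun f hf => hf.2) fun f hf j => ?_
  have hcard : ∀ F : Finset (ℝ × ℝ → ℝ × ℝ), (∀ s ∈ F, s ∈ sections f.1 P.carrier (S.T j)) →
      F.card ≤ B := by
    intro F hF
    have h1 := (card_mul_volume_le f (S.preconnected j) (S.compact j) F hF).trans
      ((ENNReal.ofReal_le_ofReal (boundaryIntegral_le hL hf.1 hf.2)).trans (hN j))
    have h2 : (F.card : ENNReal) ≤ N j := (ENNReal.mul_le_mul_iff_left (hpos j) (hfin j)).1 h1
    exact (Nat.cast_le.1 h2).trans (hB (mem_range_self j))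
  have hsec : (sections f.1 P.carrier (S.T j)).Finite := by
    by_contra h
    obtain ⟨F, hF, hFc⟩ := Set.Infinite.exists_subset_card_eq h (B + 1)
    have := hcard F fun s hs => hF hs
    omega
  refine ⟨hsec, ?_⟩
  rw [Set.ncard_eq_toFinset_card _ hsec]
  exact hcard _ fun s hs => by simpa using hs

end CurvedConvexPolygon

/-- The smallest gap is positive because there are finitely many double points, and `n` times it is
at most the gap at `a`. -/
theorem Term.exists_length_le {L : LegendrianLink} (hL : L.IsGeneric)
    (P : ∀ n, CurvedConvexPolygon n) (a : L.DoublePoint) :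
    ∃ K : ℕ, ∀ τ : Term L P a, τ.1 ≤ K := by
  have := LegendrianLink.finite_doublePoint hL
  have : Nonempty L.DoublePoint := ⟨a⟩
  obtain ⟨b, hb⟩ := Finite.exists_min fun b : L.DoublePoint => LegendrianLink.gap hL b
  have hpos := LegendrianLink.gap_pos hL b
  refine ⟨⌈LegendrianLink.gap hL a / LegendrianLink.gap hL b⌉₊, ?_⟩
  rintro ⟨n, w, _, f, ⟨hf, hfw⟩, rfl⟩
  have h1 := CurvedConvexPolygon.sum_gap_le hL hf hfw
  have h2 : (n : ℝ) * LegendrianLink.gap hL b ≤ ∑ i : Fin n, LegendrianLink.gap hL (w i) := by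
    have := Finset.sum_le_sum fun i (_ : i ∈ Finset.univ) => hb (w i)
    simpa using this
  simp only [Fin.cons_zero, Fin.cons_succ] at h1
  have h3 : (n : ℝ) ≤ LegendrianLink.gap hL a / LegendrianLink.gap hL b :=
    (le_div_iff₀ hpos).2 (h2.trans h1)
  exact Nat.cast_le.1 (h3.trans (Nat.le_ceil _))

theorem Term.finite {L : LegendrianLink} (hL : L.IsGeneric) (P : ∀ n, CurvedConvexPolygon n)
    (a : L.DoublePoint) : Finite (Term L P a) := by
  obtain ⟨K, hK⟩ := Term.exists_length_le hL P a
  have := LegendrianLink.finite_doublePoint hL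
  have hadm : ∀ n (w : Fin n → L.DoublePoint), Finite ((P n).admissible L (Fin.cons a w)) :=
    fun n w => (CurvedConvexPolygon.finite_admissible hL _).to_subtype
  let F : (Σ n : Fin (K + 1), Σ w : Fin n → L.DoublePoint,
      ((P n).admissible L (Fin.cons a w))) → Term L P a := fun x => ⟨x.1, x.2.1, x.2.2⟩
  refine Finite.of_surjective F ?_
  intro τ
  exact ⟨⟨⟨τ.1, Nat.lt_succ_of_le (hK τ)⟩, τ.2.1, τ.2.2⟩, rfl⟩

end Chekanov

end

theorem theorem3p1 (L : Chekanov.LegendrianLink) (hL : L.IsGeneric)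
    (P : ∀ n : ℕ, Chekanov.CurvedConvexPolygon n) :
    (∀ a : L.DoublePoint, Finite (Chekanov.Term L P a)) ∧
    ∃! d : Chekanov.DiagramAlgebra L →ₗ[ZMod 2] Chekanov.DiagramAlgebra L,
      (∀ x y, d (x * y) = d x * y + x * d y) ∧
      ∀ a : L.DoublePoint,
        d (FreeAlgebra.ι (ZMod 2) a) = ∑ᶠ τ : Chekanov.Term L P a, τ.monomial :=
  -- The derivation exists for any values on generators; finiteness ensures that `∑ᶠ` is the actual
  -- sum and not the default value `0`.
  ⟨fun a => Chekanov.Term.finite hL P a, Chekanov.existsUnique_derivation _⟩
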